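/- **Setting.** Let $G$ be a countable set with weights $\omega_{xy}=\omega_{yx}\ge 0$ ($x,y\in G$), and write $x\sim y$ if $\omega_{xy}>0$. Assume that the resulting graph is connected and that every $x$ has at least one and at most $M$ points $y$ with $x\sim y$. Let $d(x,y)$ be the graph distance, $B(x,R)=\{y: d(x,y)<R\}$, $\pi(x)=\sum_y\omega_{xy}$, and let $\tilde d(x,y)$ be the infimum of $\sum_{i<m}(1\wedge\omega_{x_ix_{i+1}}^{-1/2})$ over all paths $x=x_0\sim x_1\sim\dots\sim x_m=y$, with $\tilde B(x,R)=\{y:\tilde d(x,y)<R\}$. Fix one of two cases: CSRW, where $\theta_x=\pi(x)$, or VSRW, where $\theta_x=1$; put $\theta(A)=\sum_{x\in A}\theta_x$ and $\mathcal L_\theta f(x)=\theta_x^{-1}\sum_y(f(y)-f(x))\omega_{xy}$. Let $X$ be the continuous-time Markov chain on $G$ which jumps from $x$ to $y$ with probability $\omega_{xy}/\pi(x)$ after an exponential holding time of mean $1$ (CSRW) or $\pi(x)^{-1}$ (VSRW), sent to a cemetery at a possible explosion time. Put $\tau_A=\inf\{t\ge0:X_t\notin A\}$, $p_t(x,y)=P^x(X_t=y)/\theta_y$,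 and $p^A_t(x,y)=P^x(X^A_t=y)/\theta_y$, where $X^A$ is $X$ killed on exiting $A$. **Assumptions.** Let $x_0\in G$ and let $d,\delta_1,\delta_2,\delta_3,a_1,\dots,a_5,C_E,\kappa>0$ be real numbers. (The number $d$ is not to be confused with the distance $d(\cdot,\cdot)$.) Suppose that there are $T_0,R_0,R_1,R_2,R_3,R_4\in[1,\infty)$, which may depend on $G$ and $x_0$, such that: 1. $p_t(x,y)\le a_1t^{-d/2}$ for all $t\ge T_0$ and $x,y\in B(x_0,t^{(1+\delta_1)/2})$. 2. CSRW: $a_2r^2\le E^x[\tau_{B(x,r)}]$ for all $r\ge R_0$ and $x\in B(x_0,r^{1+\delta_2})$. VSRW: $a_2r^2\le E^x[\tau_{\tilde B(x,r)}]$ for all $r\ge R_0$ and $x\in\tilde B(x_0,r^{1+\delta_2})$. 3. If $R\ge R_1$ and $h$ is positive on $B(x_0,R)$ and all neighbours of its points, and $\mathcal L_\theta h=0$ on $B(x_0,R)$, then $\sup_{B(x_0,R/2)}h\le C_E\inf_{B(x_0,R/2)}h$. 4. $a_3R^d\le\theta(B(x_0,R))\le\sup_{x\in B(x_0,R^{1+\delta_3})}\theta(B(x,R))\le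 a_4R^d$ for all $R\ge R_2$. 5. CSRW: $\min_{x\in B(x_0,R)}\pi(x)\ge R^{-\kappa}$ for all $R\ge R_3$. VSRW: for all $R\ge R_4$, $x\in B(x_0,R)$ and $y\in G$ with $d(x,y)\ge R$, $\tilde d(x,y)\ge a_5\,d(x,y)$. **Proposition.** There exist $c_1,\delta_0\in(0,1)$, depending only on $M$ and the constants $d,\delta_1,\delta_2,\delta_3,a_1,\dots,a_5,C_E,\kappa$ (not otherwise on $G$ or $x_0$, nor on the thresholds $T_0,R_0,\dots,R_4$), such that under these assumptions there is $T_1=T_1(x_0)\in[1,\infty)$ (which may depend on $G$, $x_0$) with $$p_t^{B(x_0,t^{1/2})}(x,y)\ge c_1t^{-d/2}\qquad\text{for all } t\ge T_1(x_0)\text{ and } x,y\in B(x_0,\delta_0t^{1/2}).$$ -/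

import Mathlib

open MeasureTheory ProbabilityTheory Set
open scoped ENNReal NNReal

noncomputable section

namespace RandomWalk

/-- The two continuous-time walks: constant speed (CSRW) and variable speed (VSRW). -/
inductive Speed
  | csrw
  | vsrw

/-- A connected weighted graph with vertex set `V` and at most `M` neighbours per vertex;
`x ∼ y` means `0 < weight x y`. Loops (`0 < weight x x`) are allowed. The field `exists_pos` says
that the total weight at each vertex is positive, so that the jump probabilities make sense; it
follows from connectedness as soon as there are two vertices. -/
structure WeightedGraph (V : Type*) (M : ℕ) where
  weight : V → V → ℝ
  nonneg : ∀ x y, 0 ≤ weight x y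
  symm : ∀ x y, weight x y = weight y x
  degree_le : ∀ x, {y | 0 < weight x y}.encard ≤ M
  exists_pos : ∀ x, ∃ y, 0 < weight x y
  connected : (SimpleGraph.fromRel fun x y => 0 < weight x y).Connected

namespace WeightedGraph

variable {V : Type*} {M : ℕ} (G : WeightedGraph V M)

/-- The simple graph of pairs `x ≠ y` with positive weight. -/
def graph : SimpleGraph V := SimpleGraph.fromRel fun x y => 0 < G.weight x y

/-- The total weight `π(x) = ∑ y, ω_{xy}` (a finite sum). -/
def pi (x : V) : ℝ := ∑' y, G.weight x y

/-- The reference measure `θ`: `π` for the CSRW and the counting measure for the VSRW. -/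
def theta : Speed → V → ℝ
  | .csrw, x => G.pi x
  | .vsrw, _ => 1

/-- The parameter of the exponential holding time at `x`, i.e. the inverse of its mean. -/
def rate : Speed → V → ℝ
  | .csrw, _ => 1
  | .vsrw, x => G.pi x

/-- `θ(A) = ∑_{x ∈ A} θ_x`, used for finite sets `A` only. -/
def thetaSet (s : Speed) (A : Set V) : ℝ := ∑' x : A, G.theta s x

/-- The ball `B(x, R) = {y : d(x, y) < R}` for the graph distance `d`. -/
def ball (x : V) (R : ℝ) : Set V := {y | (G.graph.dist x y : ℝ) < R}

/-- The length of a path when the edge `{x, y}` has length `1 ∧ ω_{xy}^{-1/2}`. -/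
def walkLength {x y : V} (p : G.graph.Walk x y) : ℝ :=
  (p.darts.map fun e => min 1 (G.weight e.fst e.snd ^ (-(1 / 2) : ℝ))).sum

/-- The metric `d̃`: the infimum of the lengths of the paths from `x` to `y`. -/
def distTilde (x y : V) : ℝ := ⨅ p : G.graph.Walk x y, G.walkLength p

/-- The ball `{y : d̃(x, y) < R}`. -/
def ballTilde (x : V) (R : ℝ) : Set V := {y | G.distTilde x y < R}

/-- The Laplace operator `L_θ f(x) = θ_x⁻¹ ∑ y, (f(y) - f(x)) ω_{xy}`. -/
def laplace (s : Speed) (f : V → ℝ) (x : V) : ℝ :=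
  (G.theta s x)⁻¹ * ∑' y, (f y - f x) * G.weight x y

/-- The set `A` together with all neighbours of its points. -/
def closure (A : Set V) : Set V := A ∪ {y | ∃ x ∈ A, 0 < G.weight x y}

/-! ### The walk as a jump process -/

lemma finite_nbrs (x : V) : {y | 0 < G.weight x y}.Finite :=
  Set.finite_of_encard_le_coe (G.degree_le x)

lemma summable_weight (x : V) : Summable (G.weight x) := by
  refine summable_of_hasFiniteSupport ((G.finite_nbrs x).subset fun y hy => ?_)
  exact lt_of_le_of_ne (G.nonneg x y) (Ne.symm hy)

lemma pi_pos (x : V) : 0 < G.pi x := by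
  obtain ⟨y, hy⟩ := G.exists_pos x
  exact (G.summable_weight x).tsum_pos (G.nonneg x) y hy

lemma rate_pos (s : Speed) (x : V) : 0 < G.rate s x := by
  cases s
  · exact one_pos
  · exact G.pi_pos x

/-- The jump distribution from `x`: the next vertex is `y` with probability `ω_{xy} / π(x)`. -/
def jump (x : V) : PMF V :=
  ⟨fun y => ENNReal.ofReal (G.weight x y / G.pi x), by
    have h : HasSum (fun y => G.weight x y / G.pi x) 1 := by
      have := (G.summable_weight x).hasSum.div_const (G.pi x)
      rwa [show (∑' y, G.weight x y) / G.pi x = 1 from div_self (G.pi_pos x).ne'] at this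
    have h2 := ENNReal.ofReal_tsum_of_nonneg
      (fun y => div_nonneg (G.nonneg x y) (G.pi_pos x).le) h.summable
    rw [h.tsum_eq, ENNReal.ofReal_one] at h2
    exact h2 ▸ ENNReal.summable.hasSum⟩

/-- The sample space: a sequence of pairs whose entry `n` is
(the vertex after `n` jumps, the holding time before jump `n`). -/
abbrev Path (V : Type*) := ℕ → V × ℝ

section process

variable [Countable V] [MeasurableSpace V] [DiscreteMeasurableSpace V]

/-- One step from `x`: the next vertex and the holding time at `x` are independent, with laws
`ω_{x·} / π(x)` and the exponential law. -/
def step (s : Speed) : Kernel V (V × ℝ) :=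
  Kernel.ofFunOfCountable fun x => (G.jump x).toMeasure.prod (expMeasure (G.rate s x))

instance (s : Speed) : IsMarkovKernel (G.step s) :=
  ⟨fun x => by
    have := isProbabilityMeasure_expMeasure (G.rate_pos s x)
    change IsProbabilityMeasure ((G.jump x).toMeasure.prod (expMeasure (G.rate s x)))
    infer_instance⟩

/-- The step after `n` jumps, which depends on the past through the present vertex only. -/
def stepFrom (s : Speed) (n : ℕ) : Kernel (Π _ : Finset.Iic n, V × ℝ) (V × ℝ) :=
  (G.step s).comap (fun h => (h ⟨n, Finset.mem_Iic.2 le_rfl⟩).1) (by fun_prop)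

instance (s : Speed) (n : ℕ) : IsMarkovKernel (G.stepFrom s n) := by
  unfold stepFrom; infer_instance

/-- The law `P^x` of the walk started at `x`. -/
def law (s : Speed) (x : V) : Measure (Path V) :=
  Kernel.traj (X := fun _ => V × ℝ) (G.stepFrom s) 0 fun _ => (x, 0)

end process

end WeightedGraph

open WeightedGraph

variable {V : Type*}

/-- The time of the `n`-th jump (with time `0` for `n = 0`). -/
def jumpTime (w : Path V) (n : ℕ) : ℝ := ∑ i ∈ Finset.range n, (w (i + 1)).2

open Classical in
/-- The position `X_t`; it is `none` (the cemetery) after an explosion. -/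
def position (w : Path V) (t : ℝ) : Option V :=
  if h : ∃ n, jumpTime w n ≤ t ∧ t < jumpTime w (n + 1) then some (w (Nat.find h)).1 else none

/-- The exit time `τ_A = inf {t ≥ 0 : X_t ∉ A}`. -/
def exitTime (A : Set V) (w : Path V) : ℝ≥0∞ :=
  ⨅ (t : ℝ≥0) (_ : ¬ ∃ y ∈ A, position w t = some y), (t : ℝ≥0∞)

open Classical in
/-- The process `X^A` killed on exiting `A`. -/
def killed (A : Set V) (w : Path V) (t : ℝ) : Option V :=
  if ENNReal.ofReal t < exitTime A w then position w t else none

namespace WeightedGraph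

variable {M : ℕ} [Countable V] [MeasurableSpace V] [DiscreteMeasurableSpace V]
  (G : WeightedGraph V M) (s : Speed)

/-- The heat kernel `p_t(x, y) = P^x(X_t = y) / θ_y`. -/
def heatKernel (t : ℝ) (x y : V) : ℝ :=
  (G.law s x).real {w | position w t = some y} / G.theta s y

/-- The Dirichlet heat kernel `p_t^A(x, y) = P^x(X^A_t = y) / θ_y`. -/
def dirichletHeatKernel (A : Set V) (t : ℝ) (x y : V) : ℝ :=
  (G.law s x).real {w | killed A w t = some y} / G.theta s y

/-- The mean exit time `E^x[τ_A]`. -/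
def meanExitTime (A : Set V) (x : V) : ℝ≥0∞ := ∫⁻ w, exitTime A w ∂(G.law s x)

end WeightedGraph

/-- The exponent `d` and the constants in the assumptions on the walk. -/
structure Constants where
  (d δ₁ δ₂ δ₃ c₁ c₂ c₃ c₄ c₅ C_E κ : ℝ)
  d_pos : 0 < d
  δ₁_pos : 0 < δ₁
  δ₂_pos : 0 < δ₂
  δ₃_pos : 0 < δ₃
  c₁_pos : 0 < c₁
  c₂_pos : 0 < c₂
  c₃_pos : 0 < c₃
  c₄_pos : 0 < c₄
  c₅_pos : 0 < c₅
  C_E_pos : 0 < C_E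
  κ_pos : 0 < κ

/-- The standing assumptions on the walk around the distinguished vertex `x₀`. -/
structure Assumptions {M : ℕ} [Countable V] [MeasurableSpace V] [DiscreteMeasurableSpace V]
    (K : Constants) (G : WeightedGraph V M) (s : Speed) (x₀ : V) : Prop where
  /-- On-diagonal upper bound of the heat kernel. -/
  heatKernel_le : ∃ T₀ : ℝ, 1 ≤ T₀ ∧ ∀ t, T₀ ≤ t →
    ∀ x ∈ G.ball x₀ (t ^ ((1 + K.δ₁) / 2)), ∀ y ∈ G.ball x₀ (t ^ ((1 + K.δ₁) / 2)),
      G.heatKernel s t x y ≤ K.c₁ * t ^ (-K.d / 2)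
  /-- Lower bound of mean exit times, in terms of `d` for the CSRW. -/
  exit_csrw : s = .csrw → ∃ R₀ : ℝ, 1 ≤ R₀ ∧ ∀ r, R₀ ≤ r →
    ∀ x ∈ G.ball x₀ (r ^ (1 + K.δ₂)),
      ENNReal.ofReal (K.c₂ * r ^ 2) ≤ G.meanExitTime s (G.ball x r) x
  /-- Lower bound of mean exit times, in terms of `d̃` for the VSRW. -/
  exit_vsrw : s = .vsrw → ∃ R₀ : ℝ, 1 ≤ R₀ ∧ ∀ r, R₀ ≤ r →
    ∀ x ∈ G.ballTilde x₀ (r ^ (1 + K.δ₂)),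
      ENNReal.ofReal (K.c₂ * r ^ 2) ≤ G.meanExitTime s (G.ballTilde x r) x
  /-- Elliptic Harnack inequality. -/
  harnack : ∃ R₁ : ℝ, 1 ≤ R₁ ∧ ∀ R, R₁ ≤ R → ∀ h : V → ℝ,
    (∀ x ∈ G.closure (G.ball x₀ R), 0 < h x) → (∀ x ∈ G.ball x₀ R, G.laplace s h x = 0) →
      ∀ x ∈ G.ball x₀ (R / 2), ∀ y ∈ G.ball x₀ (R / 2), h x ≤ K.C_E * h y
  /-- Volume growth. -/
  volume : ∃ R₂ : ℝ, 1 ≤ R₂ ∧ ∀ R, R₂ ≤ R →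
    K.c₃ * R ^ K.d ≤ G.thetaSet s (G.ball x₀ R) ∧
    ∀ x ∈ G.ball x₀ (R ^ (1 + K.δ₃)), G.thetaSet s (G.ball x R) ≤ K.c₄ * R ^ K.d
  /-- Polynomial lower bound of `π` for the CSRW. -/
  pi_csrw : s = .csrw → ∃ R₃ : ℝ, 1 ≤ R₃ ∧ ∀ R, R₃ ≤ R →
    ∀ x ∈ G.ball x₀ R, R ^ (-K.κ) ≤ G.pi x
  /-- Comparison of `d̃` with `d` for the VSRW. -/
  dist_vsrw : s = .vsrw → ∃ R₄ : ℝ, 1 ≤ R₄ ∧ ∀ R, R₄ ≤ R →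
    ∀ x ∈ G.ball x₀ R, ∀ y, R ≤ (G.graph.dist x y : ℝ) →
      K.c₅ * (G.graph.dist x y : ℝ) ≤ G.distTilde x y

end RandomWalk

end

namespace RandomWalk
namespace WeightedGraph

variable {V : Type*} {M : ℕ} (G : WeightedGraph V M)

/-! ### Elementary facts on weighted graphs -/

/-! For a ball `D = B(x₀, r)`, which is finite, the Dirichlet Laplacian is self-adjoint in `ℓ²(θ)`.
Its semigroup has the kernel `∑ exp(λᵢ t) φᵢ(x) φᵢ(y)`, and `Eigenbasis.prob_killed_eq` identifies
this with the transition density of the killed walk: iterating the first-jump decomposition counts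
jumps, and the remainder dies geometrically. After that the proof is analytic.

On-diagonal bound. The upper bound of the heat kernel and the volume bound give survival probability
at most `1/2` at time `A r²`. Hence `E τ ≤ ℓ + 2 A r² P(τ > ℓ)`, and the lower bound `E τ ≥ b r²`
forces `P(τ > ℓ) ≥ b / (4A)` for `ℓ ≤ b r² / 2` (`le_survival`). Cauchy–Schwarz and the volume bound
turn this into `p_{2ℓ}(x₀, x₀) ≥ c r^{-d}` (`le_kernel_diag`).

Near-diagonal bound. At time `τ = r² / k` the function `p_τ(x, ·)` has Laplacian `∂_τ p_τ(x, ·)`, of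
order `r^{-d} / τ`. On the smaller ball `B(x₀, ηr)` a Poisson solution with this right-hand side has
size of order `η² k r^{-d}`; subtracting it leaves a harmonic function, whose oscillation decays by
the elliptic Harnack inequality (`kernel_sub_le`). With `η` small and then many oscillation steps,
`p_τ` varies by at most `c r^{-d} / 4` in each variable near `x₀`, so it is at least `c r^{-d} / 2`
there.

The survival estimate is available only at times up to a small multiple of `r²`, so `k` steps of
length `τ` are chained by the semigroup property to reach time `r²` (`le_kernel_chain`). Each
intermediate sum over `B(x₀, ρr)` contributes a volume of order `r^d`, which cancels one factor
`r^{-d}`. -/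

lemma theta_pos (s : Speed) (x : V) : 0 < G.theta s x := by
  cases s
  · exact G.pi_pos x
  · exact one_pos

lemma theta_mul_rate (s : Speed) (x : V) : G.theta s x * G.rate s x = G.pi x := by
  cases s <;> simp [theta, rate]

lemma sum_weight_le_pi (x : V) (D : Finset V) : ∑ y ∈ D, G.weight x y ≤ G.pi x :=
  (G.summable_weight x).sum_le_tsum D fun y _ => G.nonneg x y

lemma summable_mul_weight (f : V → ℝ) (x : V) : Summable fun y => f y * G.weight x y := by
  refine summable_of_hasFiniteSupport ((G.finite_nbrs x).subset fun y hy => ?_)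
  exact lt_of_le_of_ne (G.nonneg x y) (Ne.symm (right_ne_zero_of_mul hy))

lemma laplace_eq (s : Speed) (f : V → ℝ) (x : V) :
    G.laplace s f x = (G.theta s x)⁻¹ * (∑' y, f y * G.weight x y) - G.rate s x * f x := by
  have h : ∑' y, (f y - f x) * G.weight x y = (∑' y, f y * G.weight x y) - f x * G.pi x := by
    simp_rw [sub_mul]
    rw [(G.summable_mul_weight f x).tsum_sub ((G.summable_weight x).mul_left _), tsum_mul_left]
    rfl
  rw [laplace, h, ← G.theta_mul_rate s x]
  have := (G.theta_pos s x).ne'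
  field_simp

lemma laplace_of_support {s : Speed} {f : V → ℝ} {D : Finset V} (hf : ∀ x, x ∉ D → f x = 0)
    (x : V) : G.laplace s f x =
      (G.theta s x)⁻¹ * (∑ y ∈ D, f y * G.weight x y) - G.rate s x * f x := by
  rw [laplace_eq, tsum_eq_sum fun y hy => by rw [hf y hy, zero_mul]]

lemma laplace_sum (s : Speed) {ι : Type*} (I : Finset ι) (c : ι → ℝ) (f : ι → V → ℝ) (x : V) :
    G.laplace s (fun y => ∑ i ∈ I, c i * f i y) x = ∑ i ∈ I, c i * G.laplace s (f i) x := by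
  simp_rw [laplace_eq, Finset.sum_mul]
  rw [Summable.tsum_finsetSum fun i _ => G.summable_mul_weight (fun y => c i * f i y) x]
  simp_rw [mul_assoc, tsum_mul_left, mul_sub, Finset.sum_sub_distrib, Finset.mul_sum]
  congr 1 <;> exact Finset.sum_congr rfl fun i _ => by ring

lemma laplace_sub (s : Speed) (f g : V → ℝ) (x : V) :
    G.laplace s (fun y => f y - g y) x = G.laplace s f x - G.laplace s g x := by
  have := (G.summable_mul_weight f x).tsum_sub (G.summable_mul_weight g x)
  simp_rw [laplace_eq, sub_mul, this]
  ring

lemma laplace_neg (s : Speed) (f : V → ℝ) (x : V) :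
    G.laplace s (fun y => - f y) x = - G.laplace s f x := by
  simp_rw [laplace_eq, neg_mul, tsum_neg]
  ring

lemma laplace_add_const (s : Speed) (f : V → ℝ) (c : ℝ) (x : V) :
    G.laplace s (fun y => f y + c) x = G.laplace s f x := by
  simp [laplace]

lemma graph_connected : G.graph.Connected := G.connected

lemma graph_adj_iff (x y : V) : G.graph.Adj x y ↔ x ≠ y ∧ 0 < G.weight x y := by
  simp [graph, G.symm y x]

lemma dist_le_succ {x y z : V} (h : 0 < G.weight y z) :
    G.graph.dist x z ≤ G.graph.dist x y + 1 := by
  by_cases hyz : y = z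
  · subst hyz; omega
  · have h1 := G.graph_connected.dist_triangle (u := x) (v := y) (w := z)
    rwa [(SimpleGraph.dist_eq_one_iff_adj).2 ((G.graph_adj_iff y z).2 ⟨hyz, h⟩)] at h1

lemma finite_dist_le (x : V) (n : ℕ) : {y | G.graph.dist x y ≤ n}.Finite := by
  induction n with
  | zero =>
    refine (Set.finite_singleton x).subset fun y hy => ?_
    have := (G.graph_connected.dist_eq_zero_iff (u := x) (v := y)).1 (Nat.le_zero.1 hy)
    simp [this]
  | succ n ih =>
    refine (ih.union (ih.biUnion fun y _ => G.finite_nbrs y)).subset fun z hz => ?_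
    by_cases h : G.graph.dist x z ≤ n
    · exact Or.inl h
    · have hz' : G.graph.dist x z = n + 1 := le_antisymm hz (by omega)
      obtain ⟨p, hp⟩ := G.graph_connected.exists_walk_length_eq_dist z x
      rw [SimpleGraph.dist_comm, hz'] at hp
      cases p with
      | nil => simp at hp
      | @cons _ y _ hadj q =>
        simp only [SimpleGraph.Walk.length_cons, add_left_inj] at hp
        refine Or.inr (Set.mem_biUnion (x := y) ?_ ?_)
        · change G.graph.dist x y ≤ n
          rw [SimpleGraph.dist_comm]
          exact (SimpleGraph.dist_le q).trans hp.le
        · exact ((G.graph_adj_iff _ _).1 hadj.symm).2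

lemma finite_ball (x : V) (R : ℝ) : (G.ball x R).Finite := by
  refine (G.finite_dist_le x ⌈R⌉₊).subset fun y hy => ?_
  exact_mod_cast (hy.le.trans (Nat.le_ceil R))

lemma ball_mono (x : V) {R S : ℝ} (h : R ≤ S) : G.ball x R ⊆ G.ball x S :=
  fun _ hy => lt_of_lt_of_le hy h

lemma mem_ball_self (x : V) {R : ℝ} (h : 0 < R) : x ∈ G.ball x R := by
  simpa [ball] using h

lemma closure_ball_subset (x : V) (R : ℝ) : G.closure (G.ball x R) ⊆ G.ball x (R + 1) := by
  rintro z (hz | ⟨y, hy, hyz⟩)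
  · exact G.ball_mono x (by linarith) hz
  · have h1 : (G.graph.dist x z : ℝ) ≤ G.graph.dist x y + 1 := by
      exact_mod_cast G.dist_le_succ (x := x) hyz
    have h2 : (G.graph.dist x y : ℝ) < R := hy
    change (G.graph.dist x z : ℝ) < R + 1
    linarith

lemma thetaSet_coe (s : Speed) (D : Finset V) :
    G.thetaSet s (D : Set V) = ∑ x ∈ D, G.theta s x :=
  D.tsum_subtype (G.theta s)

lemma walkLength_nonneg {x y : V} (p : G.graph.Walk x y) : 0 ≤ G.walkLength p := by
  refine List.sum_nonneg fun a ha => ?_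
  obtain ⟨e, -, rfl⟩ := List.mem_map.1 ha
  exact le_min zero_le_one (Real.rpow_nonneg (G.nonneg _ _) _)

lemma distTilde_self_le (x : V) : G.distTilde x x ≤ 0 := by
  refine (ciInf_le ⟨0, ?_⟩ SimpleGraph.Walk.nil).trans ?_
  · rintro _ ⟨p, rfl⟩
    exact G.walkLength_nonneg p
  · simp [walkLength]

end WeightedGraph
end RandomWalk

namespace RandomWalk
namespace WeightedGraph

variable {V : Type*} {M : ℕ} {G : WeightedGraph V M} {s : Speed} {D : Finset V}

/-! ### The spectral decomposition of the Dirichlet Laplacian on a finite set -/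

open Classical in
/-- An eigenbasis of the Laplace operator on `D` with zero boundary values, orthonormal with
respect to `θ`. -/
structure Eigenbasis (G : WeightedGraph V M) (s : Speed) (D : Finset V) where
  /-- The eigenvalues. -/
  ev : D → ℝ
  /-- The eigenfunctions, extended by zero. -/
  fn : D → V → ℝ
  fn_off : ∀ i, ∀ x, x ∉ D → fn i x = 0
  laplace_fn : ∀ i, ∀ x ∈ D, G.laplace s (fn i) x = ev i * fn i x
  orthonormal : ∀ i j, ∑ x ∈ D, G.theta s x * (fn i x * fn j x) = if i = j then 1 else 0
  complete : ∀ x ∈ D, ∀ y ∈ D, ∑ i, fn i x * fn i y = if x = y then (G.theta s x)⁻¹ else 0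

open Classical in
-- Conjugating the Laplacian by `√θ` gives a symmetric matrix, so the spectral theorem applies.
-- Dividing its orthonormal eigenvectors by `√θ` makes them orthonormal for `θ`; completeness is
-- orthogonality of the rows of the eigenvector matrix.
theorem exists_eigenbasis (G : WeightedGraph V M) (s : Speed) (D : Finset V) :
    Nonempty (G.Eigenbasis s D) := by
  set r : V → ℝ := fun x => √(G.theta s x)
  have hr : ∀ x, 0 < r x := fun x => Real.sqrt_pos.2 (G.theta_pos s x)
  have hrr : ∀ x, r x * r x = G.theta s x := fun x => Real.mul_self_sqrt (G.theta_pos s x).le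
  let A : Matrix D D ℝ := fun x y =>
    (r x)⁻¹ * (r y)⁻¹ * (G.weight x y - if x = y then G.pi x else 0)
  have hA : A.IsHermitian := by
    ext x y
    rw [Matrix.conjTranspose_apply, star_trivial]
    by_cases h : x = y
    · subst h; rfl
    · simp [A, h, Ne.symm h, G.symm y x, mul_comm (r x)⁻¹]
  let U : Matrix D D ℝ := hA.eigenvectorUnitary
  have hU1 : ∀ i j, ∑ x, U x i * U x j = if i = j then 1 else 0 := by
    intro i j
    have := congrFun (congrFun (Unitary.coe_star_mul_self hA.eigenvectorUnitary) i) j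
    rw [Matrix.mul_apply, Matrix.one_apply] at this
    simpa [Matrix.star_apply, U] using this
  have hU2 : ∀ x y, ∑ i, U x i * U y i = if x = y then 1 else 0 := by
    intro x y
    have := congrFun (congrFun (Unitary.coe_mul_star_self hA.eigenvectorUnitary) x) y
    rw [Matrix.mul_apply, Matrix.one_apply] at this
    simpa [Matrix.star_apply, U] using this
  have hUA : ∀ i x, ∑ y, A x y * U y i = hA.eigenvalues i * U x i := by
    intro i x
    have := congrFun (hA.mulVec_eigenvectorBasis i) x
    simpa [Matrix.mulVec, dotProduct, U] using this
  let f : D → V → ℝ := fun i x => if h : x ∈ D then (r x)⁻¹ * U ⟨x, h⟩ i else 0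
  have hf : ∀ i (x : D), f i x = (r x)⁻¹ * U x i := fun i x => by simp [f]
  have hf0 : ∀ i x, x ∉ D → f i x = 0 := fun i x hx => by simp [f, hx]
  refine ⟨⟨hA.eigenvalues, f, hf0, ?_, ?_, ?_⟩⟩
  · intro i x hx
    lift x to D using hx
    rw [G.laplace_of_support (hf0 i), ← D.sum_coe_sort (fun y => f i y * G.weight x y)]
    have h := hUA i x
    have h1 : ∀ y : D, A x y * U y i = (r x)⁻¹ * (f i y * G.weight x y) -
        (r x)⁻¹ * (if x = y then G.pi x * f i x else 0) := by
      intro y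
      by_cases hxy : x = y
      · subst hxy; simp [A, hf]; ring
      · simp [A, hf, hxy]; ring
    simp_rw [h1, Finset.sum_sub_distrib, ← Finset.mul_sum] at h
    rw [Finset.sum_ite_eq, if_pos (Finset.mem_univ _), ← G.theta_mul_rate s x] at h
    have h2 : U x i = r x * f i x := by rw [hf]; field_simp [(hr x).ne']
    rw [h2] at h
    rw [← hrr x] at h ⊢
    have := (hr x).ne'
    field_simp at h ⊢
    linarith
  · intro i j
    rw [← hU1 i j, ← D.sum_coe_sort (fun x => G.theta s x * (f i x * f j x))]
    refine Finset.sum_congr rfl fun x _ => ?_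
    rw [hf, hf, ← hrr x]
    have := (hr x).ne'
    field_simp
  · intro x hx y hy
    lift x to D using hx
    lift y to D using hy
    have h := hU2 x y
    have h1 : ∀ i, f i x * f i y = (r x)⁻¹ * (r y)⁻¹ * (U x i * U y i) := fun i => by
      rw [hf, hf]; ring
    simp_rw [h1, ← Finset.mul_sum, h]
    by_cases hxy : x = y
    · subst hxy; simp [← hrr x]
    · simp [hxy]

namespace Eigenbasis

variable (E : G.Eigenbasis s D)

/-- Maximum principle: where `|fn i|` is largest, the weighted sum over neighbours is at most `π |fn
i|`, while the eigenvalue equation makes it `|ev θ + π| |fn i|`. -/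
lemma ev_nonpos (i : D) : E.ev i ≤ 0 := by
  obtain ⟨x, hx, hmax⟩ := D.exists_max_image (fun x => |E.fn i x|) ⟨i, i.2⟩
  have hpos : 0 < |E.fn i x| := by
    by_contra h
    have h0 : ∀ y ∈ D, E.fn i y = 0 := fun y hy =>
      abs_nonpos_iff.1 ((hmax y hy).trans (not_lt.1 h))
    have := E.orthonormal i i
    rw [if_pos rfl, Finset.sum_eq_zero fun y hy => by rw [h0 y hy]; ring] at this
    exact zero_ne_one this
  have h := E.laplace_fn i x hx
  rw [G.laplace_of_support (E.fn_off i)] at h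
  have hθ := G.theta_pos s x
  have h1 : ∑ y ∈ D, E.fn i y * G.weight x y = (E.ev i * G.theta s x + G.pi x) * E.fn i x := by
    rw [← G.theta_mul_rate s x]
    field_simp at h
    linarith
  have h2 : |∑ y ∈ D, E.fn i y * G.weight x y| ≤ G.pi x * |E.fn i x| := by
    refine (Finset.abs_sum_le_sum_abs _ _).trans ?_
    refine le_trans (Finset.sum_le_sum (g := fun y => |E.fn i x| * G.weight x y) fun y hy => ?_) ?_
    · rw [abs_mul, abs_of_nonneg (G.nonneg x y)]
      exact mul_le_mul_of_nonneg_right (hmax y hy) (G.nonneg x y)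
    · rw [← Finset.mul_sum, mul_comm]
      exact mul_le_mul_of_nonneg_right (G.sum_weight_le_pi x D) hpos.le
  rw [h1, abs_mul] at h2
  have h3 := le_of_mul_le_mul_right h2 hpos
  have h4 := (le_abs_self _).trans h3
  by_contra h5
  have := mul_pos (not_le.1 h5) hθ
  linarith

/-- The function `F(L)(x, y)` of the Dirichlet Laplacian. -/
noncomputable def spectralFn (F : ℝ → ℝ) (x y : V) : ℝ := ∑ i, F (E.ev i) * (E.fn i x * E.fn i y)

lemma spectralFn_comm (F : ℝ → ℝ) (x y : V) : E.spectralFn F x y = E.spectralFn F y x :=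
  Finset.sum_congr rfl fun i _ => by ring

lemma spectralFn_off_right (F : ℝ → ℝ) (x : V) {y : V} (hy : y ∉ D) : E.spectralFn F x y = 0 :=
  Finset.sum_eq_zero fun i _ => by rw [E.fn_off i y hy]; ring

lemma spectralFn_off_left (F : ℝ → ℝ) {x : V} (hx : x ∉ D) (y : V) : E.spectralFn F x y = 0 := by
  rw [spectralFn_comm, E.spectralFn_off_right F y hx]

/-- Multiplicativity of the functional calculus: orthonormality removes the off-diagonal terms of
the double sum. The semigroup property is the case of exponentials. -/
lemma sum_spectralFn_mul (F F' : ℝ → ℝ) (x y : V) :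
    ∑ z ∈ D, G.theta s z * (E.spectralFn F x z * E.spectralFn F' z y) =
      E.spectralFn (fun u => F u * F' u) x y := by
  have h : ∀ z, G.theta s z * (E.spectralFn F x z * E.spectralFn F' z y) =
      ∑ i, ∑ j, F (E.ev i) * F' (E.ev j) * (E.fn i x * E.fn j y) *
        (G.theta s z * (E.fn i z * E.fn j z)) := by
    intro z
    rw [spectralFn, spectralFn, Finset.sum_mul_sum, Finset.mul_sum]
    refine Finset.sum_congr rfl fun i _ => ?_
    rw [Finset.mul_sum]
    exact Finset.sum_congr rfl fun j _ => by ring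
  simp_rw [h]
  rw [Finset.sum_comm]
  refine Finset.sum_congr rfl fun i _ => ?_
  rw [Finset.sum_comm]
  simp_rw [← Finset.mul_sum, E.orthonormal]
  simp

lemma laplace_spectralFn (F : ℝ → ℝ) (x : V) {y : V} (hy : y ∈ D) :
    G.laplace s (fun z => E.spectralFn F x z) y = E.spectralFn (fun u => u * F u) x y := by
  have h : ∀ z, E.spectralFn F x z = ∑ i, F (E.ev i) * E.fn i x * E.fn i z := fun z =>
    Finset.sum_congr rfl fun i _ => by ring
  simp_rw [h]
  rw [laplace_sum]
  refine Finset.sum_congr rfl fun i _ => ?_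
  rw [E.laplace_fn i y hy]
  ring

lemma spectralFn_congr {F F' : ℝ → ℝ} (h : ∀ i, F (E.ev i) = F' (E.ev i)) (x y : V) :
    E.spectralFn F x y = E.spectralFn F' x y :=
  Finset.sum_congr rfl fun i _ => by rw [h]

lemma spectralFn_one [DecidableEq V] {x y : V} (hx : x ∈ D) (hy : y ∈ D) {F : ℝ → ℝ}
    (hF : ∀ u, F u = 1) : E.spectralFn F x y = if x = y then (G.theta s x)⁻¹ else 0 := by
  have := E.complete x hx y hy
  simp only [spectralFn, hF, one_mul]
  rw [this]
  congr

/-- The spectral expression of the Dirichlet heat kernel. -/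
noncomputable def kernel (t : ℝ) (x y : V) : ℝ := E.spectralFn (fun u => Real.exp (u * t)) x y

/-- The time derivative of the kernel. -/
noncomputable def kernelDeriv (t : ℝ) (x y : V) : ℝ := E.spectralFn (fun u => u * Real.exp (u * t)) x y

lemma kernel_comm (t : ℝ) (x y : V) : E.kernel t x y = E.kernel t y x := E.spectralFn_comm _ x y

lemma hasDerivAt_kernel (t : ℝ) (x y : V) :
    HasDerivAt (fun t => E.kernel t x y) (E.kernelDeriv t x y) t := by
  unfold kernel kernelDeriv spectralFn
  refine HasDerivAt.fun_sum fun i _ => ?_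
  have h := ((hasDerivAt_id t).const_mul (E.ev i)).exp.mul_const (E.fn i x * E.fn i y)
  refine h.congr_deriv ?_
  simp only [id, mul_one]
  ring

lemma continuous_kernel (x y : V) : Continuous fun t => E.kernel t x y :=
  continuous_iff_continuousAt.2 fun t => (E.hasDerivAt_kernel t x y).continuousAt

lemma kernel_zero [DecidableEq V] {x y : V} (hx : x ∈ D) (hy : y ∈ D) :
    E.kernel 0 x y = if x = y then (G.theta s x)⁻¹ else 0 :=
  E.spectralFn_one hx hy fun u => by simp

lemma sum_kernel_mul_kernel (t u : ℝ) (x y : V) :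
    ∑ z ∈ D, G.theta s z * (E.kernel t x z * E.kernel u z y) = E.kernel (t + u) x y := by
  unfold kernel
  rw [sum_spectralFn_mul]
  refine E.spectralFn_congr (fun i => ?_) x y
  rw [mul_add, Real.exp_add]

lemma laplace_kernel (t : ℝ) (x : V) {y : V} (hy : y ∈ D) :
    G.laplace s (fun z => E.kernel t x z) y = E.kernelDeriv t x y :=
  E.laplace_spectralFn _ x hy

/-- Half of the exponential absorbs the factor `ev`, because `v ≤ exp v` at `v = -ev * t / 2`. The
inequality `2|ab| ≤ a² + b²` for the eigenfunctions then leaves diagonal values at time `t / 2`. -/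
lemma abs_kernelDeriv_le {t C : ℝ} (ht : 0 < t) {x y : V}
    (hx : E.kernel (t / 2) x x ≤ C) (hy : E.kernel (t / 2) y y ≤ C) :
    |E.kernelDeriv t x y| ≤ 2 / t * C := by
  have key : ∀ i, |E.ev i * Real.exp (E.ev i * t)| ≤ 2 / t * Real.exp (E.ev i * (t / 2)) := by
    intro i
    have h0 := E.ev_nonpos i
    rw [abs_mul, abs_of_nonpos h0, abs_of_pos (Real.exp_pos _)]
    have h1 : -E.ev i * (t / 2) ≤ Real.exp (-E.ev i * (t / 2)) := by
      have := Real.add_one_le_exp (-E.ev i * (t / 2)); linarith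
    have h2 : Real.exp (E.ev i * (t / 2)) =
        Real.exp (-E.ev i * (t / 2)) * Real.exp (E.ev i * t) := by
      rw [← Real.exp_add]; congr 1; ring
    rw [h2, ← mul_assoc]
    refine mul_le_mul_of_nonneg_right ?_ (Real.exp_pos _).le
    rw [div_mul_eq_mul_div, le_div_iff₀ ht]
    linarith
  calc |E.kernelDeriv t x y|
      ≤ ∑ i, |E.ev i * Real.exp (E.ev i * t) * (E.fn i x * E.fn i y)| :=
        Finset.abs_sum_le_sum_abs _ _
    _ ≤ ∑ i, (1 / t * (Real.exp (E.ev i * (t / 2)) * (E.fn i x * E.fn i x)) +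
          1 / t * (Real.exp (E.ev i * (t / 2)) * (E.fn i y * E.fn i y))) := by
        refine Finset.sum_le_sum fun i _ => ?_
        rw [abs_mul]
        have h1 : |E.fn i x * E.fn i y| ≤
            (E.fn i x * E.fn i x + E.fn i y * E.fn i y) / 2 := by
          rw [abs_le]
          constructor <;> nlinarith [sq_nonneg (E.fn i x + E.fn i y),
            sq_nonneg (E.fn i x - E.fn i y)]
        refine (mul_le_mul (key i) h1 (abs_nonneg _) (by positivity)).trans (le_of_eq ?_)
        ring
    _ = 1 / t * E.kernel (t / 2) x x + 1 / t * E.kernel (t / 2) y y := by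
        rw [Finset.sum_add_distrib, ← Finset.mul_sum, ← Finset.mul_sum]; rfl
    _ ≤ 1 / t * C + 1 / t * C := by gcongr
    _ = 2 / t * C := by ring

end Eigenbasis
end WeightedGraph
end RandomWalk

namespace RandomWalk
namespace WeightedGraph

variable {V : Type*} {M : ℕ}

/-! ### The Markov property of the jump chain -/

/-- The path which agrees with a given history up to time `n` and is constant afterwards. -/
def extendHistory (n : ℕ) (h : Π _ : Finset.Iic n, V × ℝ) : Path V :=
  fun i => h ⟨min i n, Finset.mem_Iic.2 (min_le_right _ _)⟩

lemma measurable_extendHistory [MeasurableSpace V] (n : ℕ) : Measurable (extendHistory (V := V) n) := by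
  unfold extendHistory; fun_prop

lemma extendHistory_frestrictLe {n i : ℕ} (w : Path V) (hi : i ≤ n) :
    extendHistory n (Preorder.frestrictLe n w) i = w i := by
  simp [extendHistory, hi]

section process

variable [Countable V] [MeasurableSpace V] [DiscreteMeasurableSpace V]
  (G : WeightedGraph V M) (s : Speed)

instance (x : V) : IsProbabilityMeasure (G.law s x) := by
  unfold law; infer_instance

lemma law_map_history (x : V) (n : ℕ) :
    ((G.law s x).map (Preorder.frestrictLe n)) ⊗ₘ G.stepFrom s n =
      (G.law s x).map (fun w => (Preorder.frestrictLe n w, w (n + 1))) := by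
  have h1 := Kernel.partialTraj_compProd_eq_map_traj (X := fun _ => V × ℝ) (κ := G.stepFrom s)
    (Nat.zero_le n) (x₀ := fun _ => (x, 0))
  have h2 := Kernel.traj_map_frestrictLe_apply (X := fun _ => V × ℝ) (κ := G.stepFrom s) 0 n
    (fun _ => (x, 0))
  rw [← h2] at h1
  exact h1

/-- The value `Φ w` depends only on the history up to `n`, so the path can be replaced by its frozen
extension. The joint law of history and next step is the composition-product with the step kernel,
which disintegrates. -/
theorem lintegral_law_succ (x : V) (n : ℕ) {Φ : Path V → V × ℝ → ℝ≥0∞}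
    (hΦ : Measurable Φ.uncurry) (hdep : ∀ w w', (∀ i ≤ n, w i = w' i) → Φ w = Φ w') :
    ∫⁻ w, Φ w (w (n + 1)) ∂(G.law s x) =
      ∫⁻ w, ∫⁻ a, Φ w a ∂(G.step s (w n).1) ∂(G.law s x) := by
  have hd : ∀ w, Φ (extendHistory n (Preorder.frestrictLe n w)) = Φ w := fun w =>
    hdep _ _ fun i hi => extendHistory_frestrictLe w hi
  have hm : Measurable fun p : (Π _ : Finset.Iic n, V × ℝ) × (V × ℝ) =>
      Φ (extendHistory n p.1) p.2 :=
    hΦ.comp (((measurable_extendHistory n).comp measurable_fst).prodMk measurable_snd)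
  have h := congrArg (fun μ => ∫⁻ p, Φ (extendHistory n p.1) p.2 ∂μ) (G.law_map_history s x n)
  rw [Measure.lintegral_compProd hm, lintegral_map hm (by fun_prop),
    lintegral_map hm.lintegral_kernel_prod_right' (by fun_prop)] at h
  simp_rw [hd] at h
  exact h.symm

theorem integral_law_succ (x : V) (n : ℕ) {Φ : Path V → V × ℝ → ℝ}
    (hΦ : Measurable Φ.uncurry) (hdep : ∀ w w', (∀ i ≤ n, w i = w' i) → Φ w = Φ w')
    {C : ℝ} (hC : ∀ w a, |Φ w a| ≤ C) :
    ∫ w, Φ w (w (n + 1)) ∂(G.law s x) =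
      ∫ w, ∫ a, Φ w a ∂(G.step s (w n).1) ∂(G.law s x) := by
  have hd : ∀ w, Φ (extendHistory n (Preorder.frestrictLe n w)) = Φ w := fun w =>
    hdep _ _ fun i hi => extendHistory_frestrictLe w hi
  have hm : Measurable fun p : (Π _ : Finset.Iic n, V × ℝ) × (V × ℝ) =>
      Φ (extendHistory n p.1) p.2 :=
    hΦ.comp (((measurable_extendHistory n).comp measurable_fst).prodMk measurable_snd)
  have : IsProbabilityMeasure ((G.law s x).map (Preorder.frestrictLe n)) :=
    Measure.isProbabilityMeasure_map (by fun_prop)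
  have hi : Integrable (fun p : (Π _ : Finset.Iic n, V × ℝ) × (V × ℝ) =>
      Φ (extendHistory n p.1) p.2)
      (((G.law s x).map (Preorder.frestrictLe n)) ⊗ₘ G.stepFrom s n) :=
    Integrable.of_bound hm.aestronglyMeasurable C (Filter.Eventually.of_forall fun p => hC _ _)
  have h := congrArg (fun μ => ∫ p, Φ (extendHistory n p.1) p.2 ∂μ) (G.law_map_history s x n)
  rw [Measure.integral_compProd hi, integral_map (by fun_prop) hm.aestronglyMeasurable,
    integral_map (by fun_prop)
      hm.stronglyMeasurable.integral_kernel_prod_right'.aestronglyMeasurable] at h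
  simp_rw [hd] at h
  exact h.symm

lemma law_zero_ae (x : V) : ∀ᵐ w ∂(G.law s x), w 0 = (x, 0) := by
  have h := Kernel.traj_map_frestrictLe_apply (X := fun _ => V × ℝ) (κ := G.stepFrom s) 0 0
    (fun _ => (x, 0))
  rw [Kernel.partialTraj_self, Kernel.id_apply] at h
  have h1 : ∀ᵐ y ∂(Measure.dirac (fun _ : Finset.Iic 0 => ((x, 0) : V × ℝ))),
      y ⟨0, Finset.mem_Iic.2 le_rfl⟩ = ((x, 0) : V × ℝ) := by
    rw [ae_dirac_iff]
    exact measurableSet_eq_fun (by fun_prop) measurable_const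
  rw [← h] at h1
  exact ae_of_ae_map (by fun_prop) h1

/-! ### The exponential holding times -/

lemma step_apply (x : V) :
    G.step s x = (G.jump x).toMeasure.prod (expMeasure (G.rate s x)) := rfl

lemma measurable_expPDF (r : ℝ) : Measurable (gammaPDF 1 r) :=
  (measurable_gammaPDFReal 1 r).ennreal_ofReal

lemma lintegral_expMeasure (r : ℝ) {f : ℝ → ℝ≥0∞} (hf : Measurable f) :
    ∫⁻ u, f u ∂(expMeasure r) = ∫⁻ u, exponentialPDF r u * f u := by
  rw [expMeasure, gammaMeasure, lintegral_withDensity_eq_lintegral_mul _ (measurable_expPDF r) hf]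
  rfl

lemma expMeasure_Iic_zero (r : ℝ) : expMeasure r (Iic 0) = 0 := by
  rw [expMeasure, gammaMeasure, withDensity_apply _ measurableSet_Iic,
    ← setLIntegral_congr Iio_ae_eq_Iic]
  exact lintegral_gammaPDF_of_nonpos le_rfl

/-- The density of rate `r` times `exp (-u)` is `r / (r + 1)` times the density of rate `r + 1`.
This ratio is the gain per jump in the bound on the number of jumps. -/
lemma lintegral_exp_neg_expMeasure {r : ℝ} (hr : 0 < r) :
    ∫⁻ u, ENNReal.ofReal (Real.exp (-u)) ∂(expMeasure r) = ENNReal.ofReal (r / (r + 1)) := by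
  rw [lintegral_expMeasure r (by fun_prop)]
  have h : ∀ u, exponentialPDF r u * ENNReal.ofReal (Real.exp (-u)) =
      ENNReal.ofReal (r / (r + 1)) * exponentialPDF (r + 1) u := by
    intro u
    rw [exponentialPDF_eq, exponentialPDF_eq]
    split_ifs
    · rw [← ENNReal.ofReal_mul (by positivity), ← ENNReal.ofReal_mul (by positivity)]
      congr 1
      rw [mul_assoc, ← Real.exp_add]
      have : r + 1 ≠ 0 := by positivity
      field_simp
      congr 1
      ring
    · simp
  simp_rw [h]
  rw [lintegral_const_mul _ (by exact measurable_expPDF _), lintegral_exponentialPDF_eq_one (by positivity), mul_one]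

lemma integral_expMeasure_Iic {r u : ℝ} (hr : 0 < r) (hu : 0 ≤ u) (f : ℝ → ℝ) :
    ∫ v, (if v ≤ u then f v else 0) ∂(expMeasure r) =
      ∫ v in (0 : ℝ)..u, r * Real.exp (-(r * v)) * f v := by
  rw [expMeasure, gammaMeasure, integral_withDensity_eq_integral_toReal_smul (measurable_expPDF r)
    (Filter.Eventually.of_forall fun _ => ENNReal.ofReal_lt_top),
    intervalIntegral.integral_of_le hu, ← integral_Icc_eq_integral_Ioc,
    ← integral_indicator measurableSet_Icc]
  congr 1
  ext v
  have h : gammaPDF 1 r v = exponentialPDF r v := rfl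
  rw [h, exponentialPDF_eq, indicator_apply]
  by_cases h0 : 0 ≤ v <;> by_cases h1 : v ≤ u
  · rw [if_pos h0, if_pos h1, if_pos ⟨h0, h1⟩, ENNReal.toReal_ofReal (by positivity), smul_eq_mul]
  · simp [h1]
  · simp [h0]
  · simp [h1]

lemma ae_step_pos (x : V) : ∀ᵐ a ∂(G.step s x), 0 < a.2 := by
  have := isProbabilityMeasure_expMeasure (G.rate_pos s x)
  have h : ∀ᵐ u ∂(expMeasure (G.rate s x)), 0 < u := by
    rw [ae_iff]
    simpa [Set.Iic_def] using expMeasure_Iic_zero (G.rate s x)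
  rw [step_apply]
  exact Measure.quasiMeasurePreserving_snd.ae h

/-- Makes the jump times strictly increasing almost surely, so that the index selected in `position`
is the only one. -/
lemma ae_holding_pos (x : V) : ∀ᵐ w ∂(G.law s x), ∀ n, 0 < (w (n + 1)).2 := by
  rw [ae_all_iff]
  intro n
  have hm : MeasurableSet {a : V × ℝ | a.2 ≤ 0} := measurableSet_le measurable_snd measurable_const
  have h := G.lintegral_law_succ s x n (Φ := fun _ => indicator {a | a.2 ≤ 0} 1)
    ((measurable_one.indicator hm).comp measurable_snd) (fun _ _ _ => rfl)
  simp_rw [lintegral_indicator_one hm] at h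
  have h0 : ∀ y, G.step s y {a : V × ℝ | a.2 ≤ 0} = 0 := fun y => by
    have := G.ae_step_pos s y
    rw [ae_iff] at this
    simpa using this
  simp_rw [h0, lintegral_zero] at h
  have hm' : Measurable fun w : Path V => indicator {a : V × ℝ | a.2 ≤ 0} (1 : V × ℝ → ℝ≥0∞)
      (w (n + 1)) := (measurable_one.indicator hm).comp (measurable_pi_apply _)
  rw [lintegral_eq_zero_iff hm'] at h
  filter_upwards [h] with w hw
  by_contra hn
  simp only [Pi.zero_apply] at hw
  rw [indicator_of_mem (by exact not_lt.1 hn)] at hw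
  exact one_ne_zero hw

end process
end WeightedGraph
end RandomWalk

namespace RandomWalk

/-! ### Jump times and the killed walk -/

section path

open WeightedGraph

variable {V : Type*}

lemma jumpTime_succ (w : Path V) (n : ℕ) :
    jumpTime w (n + 1) = jumpTime w n + (w (n + 1)).2 :=
  Finset.sum_range_succ _ _

lemma jumpTime_zero (w : Path V) : jumpTime w 0 = 0 := Finset.sum_range_zero _

lemma jumpTime_congr {w w' : Path V} {n : ℕ} (h : ∀ i ≤ n, w i = w' i) :
    jumpTime w n = jumpTime w' n :=
  Finset.sum_congr rfl fun i hi => by rw [h (i + 1) (Finset.mem_range.1 hi)]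

lemma strictMono_jumpTime {w : Path V} (hw : ∀ n, 0 < (w (n + 1)).2) :
    StrictMono (jumpTime w) :=
  strictMono_nat_of_lt_succ fun n => by rw [jumpTime_succ]; linarith [hw n]

lemma jump_index_unique {w : Path V} (hw : ∀ n, 0 < (w (n + 1)).2) {t : ℝ} {m n : ℕ}
    (hm : jumpTime w m ≤ t) (hm' : t < jumpTime w (m + 1))
    (hn : jumpTime w n ≤ t) (hn' : t < jumpTime w (n + 1)) : m = n := by
  have h1 := (strictMono_jumpTime hw).lt_iff_lt.1 (hm.trans_lt hn')
  have h2 := (strictMono_jumpTime hw).lt_iff_lt.1 (hn.trans_lt hm')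
  omega

lemma position_eq {w : Path V} (hw : ∀ n, 0 < (w (n + 1)).2) {t : ℝ} {n : ℕ}
    (h : jumpTime w n ≤ t) (h' : t < jumpTime w (n + 1)) : position w t = some (w n).1 := by
  classical
  have hex : ∃ n, jumpTime w n ≤ t ∧ t < jumpTime w (n + 1) := ⟨n, h, h'⟩
  rw [position, dif_pos hex]
  obtain ⟨h1, h2⟩ := Nat.find_spec hex
  congr 3
  convert jump_index_unique hw h1 h2 h h'

lemma exists_of_position_eq {w : Path V} {t : ℝ} {y : V} (h : position w t = some y) :
    ∃ n, jumpTime w n ≤ t ∧ t < jumpTime w (n + 1) ∧ (w n).1 = y := by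
  classical
  unfold position at h
  split_ifs at h with hex
  exact ⟨_, (Nat.find_spec hex).1, (Nat.find_spec hex).2, by convert Option.some.inj h⟩

lemma position_of_lt_exitTime {A : Set V} {w : Path V} {t : ℝ} (ht : 0 ≤ t)
    (h : ENNReal.ofReal t < exitTime A w) : ∃ y ∈ A, position w t = some y := by
  by_contra hn
  have h1 : exitTime A w ≤ (t.toNNReal : ℝ≥0∞) :=
    iInf₂_le t.toNNReal (by rwa [Real.coe_toNNReal t ht])
  exact absurd h (not_lt.2 h1)

/-- The event that the walk has stayed in `A` and is at `y` at time `t` after `n` jumps. -/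
def occupation (A : Set V) (t : ℝ) (y : V) (n : ℕ) : Set (Path V) :=
  {w | (∀ i ≤ n, (w i).1 ∈ A) ∧ (w n).1 = y ∧ jumpTime w n ≤ t ∧ t < jumpTime w (n + 1)}

/-- The trajectory is a step function: a walk alive at time `t` has been in `A` at every earlier
jump time. Conversely, if the first `n + 1` vertices lie in `A`, the exit time is at least the time
of jump `n + 1`. -/
lemma killed_eq_some_iff {A : Set V} {w : Path V} (hw : ∀ n, 0 < (w (n + 1)).2) {t : ℝ}
    (ht : 0 ≤ t) (y : V) : killed A w t = some y ↔ ∃ n, w ∈ occupation A t y n := by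
  have hT := strictMono_jumpTime hw
  constructor
  · intro h
    unfold killed at h
    split_ifs at h with hlt
    obtain ⟨n, h1, h2, h3⟩ := exists_of_position_eq h
    refine ⟨n, fun i hi => ?_, h3, h1, h2⟩
    have h0 : 0 ≤ jumpTime w i := by
      rw [← jumpTime_zero w]; exact hT.monotone (Nat.zero_le i)
    have hi' : jumpTime w i ≤ t := (hT.monotone hi).trans h1
    obtain ⟨z, hz, hz'⟩ := position_of_lt_exitTime h0
      ((ENNReal.ofReal_le_ofReal hi').trans_lt hlt)
    rw [position_eq hw le_rfl (hT (Nat.lt_succ_self i))] at hz'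
    rwa [Option.some.inj hz']
  · rintro ⟨n, hA, hy, h1, h2⟩
    have hlt : ENNReal.ofReal t < exitTime A w := by
      have : ENNReal.ofReal (jumpTime w (n + 1)) ≤ exitTime A w := by
        refine le_iInf₂ fun u hu => ?_
        by_contra hlt
        rw [not_le, ← ENNReal.ofReal_coe_nnreal, ENNReal.ofReal_lt_ofReal_iff
          (ht.trans_lt h2)] at hlt
        refine hu ?_
        -- The least such `m` is the index of the holding interval containing `u`: minimality gives
        -- `jumpTime w m ≤ u`.
        have hex : ∃ m, (u : ℝ) < jumpTime w (m + 1) := ⟨n, hlt⟩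
        classical
        have hm := Nat.find_spec hex
        have hmn : Nat.find hex ≤ n := Nat.find_min' hex hlt
        refine ⟨_, hA _ hmn, position_eq hw ?_ hm⟩
        rcases Nat.eq_zero_or_pos (Nat.find hex) with h0 | h0
        · rw [h0, jumpTime_zero]; exact u.2
        · obtain ⟨k, hk⟩ := Nat.exists_eq_succ_of_ne_zero h0.ne'
          have := Nat.find_min hex (m := k) (by omega)
          rw [hk]
          exact not_lt.1 this
      exact ((ENNReal.ofReal_lt_ofReal_iff (ht.trans_lt h2)).2 h2).trans_le this
    rw [killed, if_pos hlt, position_eq hw h1 h2, hy]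

lemma measurable_jumpTime [MeasurableSpace V] (n : ℕ) :
    Measurable fun w : Path V => jumpTime w n := by
  unfold jumpTime; fun_prop

lemma measurableSet_alive [Countable V] [MeasurableSpace V] [DiscreteMeasurableSpace V]
    (A : Set V) (n : ℕ) : MeasurableSet {w : Path V | ∀ i ≤ n, (w i).1 ∈ A} := by
  have : {w : Path V | ∀ i ≤ n, (w i).1 ∈ A} = ⋂ i, ⋂ _ : i ≤ n, {w | (w i).1 ∈ A} := by
    ext; simp
  rw [this]
  refine MeasurableSet.iInter fun i => MeasurableSet.iInter fun _ => ?_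
  exact (measurable_fst.comp (measurable_pi_apply i)) (MeasurableSet.of_discrete (s := A))

lemma measurableSet_occupation [Countable V] [MeasurableSpace V] [DiscreteMeasurableSpace V]
    (A : Set V) (t : ℝ) (y : V) (n : ℕ) : MeasurableSet (occupation A t y n) := by
  refine (measurableSet_alive A n).inter (MeasurableSet.inter ?_ (MeasurableSet.inter ?_ ?_))
  · exact (measurable_fst.comp (measurable_pi_apply n)) (MeasurableSet.of_discrete (s := {y}))
  · exact measurableSet_le (measurable_jumpTime n) measurable_const
  · exact measurableSet_lt measurable_const (measurable_jumpTime (n + 1))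

end path

/-! ### The backward equation for the spectral kernel. -/

namespace WeightedGraph

variable {V : Type*} {M : ℕ} {G : WeightedGraph V M} {s : Speed} {D : Finset V}

namespace Eigenbasis

variable (E : G.Eigenbasis s D)

lemma kernelDeriv_eq (t : ℝ) {x : V} (hx : x ∈ D) (y : V) :
    E.kernelDeriv t x y = (G.theta s x)⁻¹ * (∑ z ∈ D, E.kernel t z y * G.weight x z) -
      G.rate s x * E.kernel t x y := by
  have h : E.kernelDeriv t x y = E.kernelDeriv t y x := E.spectralFn_comm _ x y
  rw [h, ← E.laplace_kernel t y hx, G.laplace_of_support (D := D) (f := fun z => E.kernel t y z)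
    fun z hz => E.spectralFn_off_right _ y hz]
  simp_rw [E.kernel_comm t y]

/-- A bound of the kernel for nonnegative times. -/
noncomputable def bound (y : V) : ℝ := ∑ z ∈ D, ∑ i, |E.fn i z * E.fn i y|

lemma bound_nonneg (y : V) : 0 ≤ E.bound y :=
  Finset.sum_nonneg fun _ _ => Finset.sum_nonneg fun _ _ => abs_nonneg _

lemma abs_kernel_le_bound {t : ℝ} (ht : 0 ≤ t) (x y : V) : |E.kernel t x y| ≤ E.bound y := by
  by_cases hx : x ∈ D
  · refine ((Finset.abs_sum_le_sum_abs _ _).trans (Finset.sum_le_sum fun i _ => ?_)).trans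
      (Finset.single_le_sum (f := fun z => ∑ i, |E.fn i z * E.fn i y|)
        (fun _ _ => Finset.sum_nonneg fun _ _ => abs_nonneg _) hx)
    rw [abs_mul, abs_of_pos (Real.exp_pos _)]
    refine mul_le_of_le_one_left (abs_nonneg _) (Real.exp_le_one_iff.2 ?_)
    exact mul_nonpos_of_nonpos_of_nonneg (E.ev_nonpos i) ht
  · rw [show E.kernel t x y = 0 from E.spectralFn_off_left _ hx y, abs_zero]
    exact E.bound_nonneg y

/-- The transition function to `y`, set to zero for negative times. -/
noncomputable def trans (y : V) (u : ℝ) (z : V) : ℝ :=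
  if 0 ≤ u then G.theta s y * E.kernel u z y else 0

lemma abs_trans_le (y : V) (u : ℝ) (z : V) : |E.trans y u z| ≤ G.theta s y * E.bound y := by
  have hθ := (G.theta_pos s y).le
  unfold trans
  split_ifs with h
  · rw [abs_mul, abs_of_nonneg hθ]
    exact mul_le_mul_of_nonneg_left (E.abs_kernel_le_bound h z y) hθ
  · rw [abs_zero]
    exact mul_nonneg hθ (E.bound_nonneg y)

lemma trans_off (y : V) (u : ℝ) {z : V} (hz : z ∉ D) : E.trans y u z = 0 := by
  rw [trans, show E.kernel u z y = 0 from E.spectralFn_off_left _ hz y]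
  simp

lemma measurable_trans (y z : V) : Measurable fun u => E.trans y u z :=
  Measurable.ite measurableSet_Ici (by exact ((E.continuous_kernel z y).measurable.const_mul _))
    measurable_const

open Classical in
/-- The integrated backward equation. -/
lemma backward_equation {x y : V} (hx : x ∈ D) (hy : y ∈ D) {u : ℝ} (hu : 0 ≤ u) :
    (if x = y then (1 : ℝ) else 0) *
        (1 - ∫ v in (0 : ℝ)..u, G.rate s x * Real.exp (-(G.rate s x * v)) * 1) +
      ∑ z ∈ D, G.weight x z / G.pi x *
        (∫ v in (0 : ℝ)..u, G.rate s x * Real.exp (-(G.rate s x * v)) *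
          (G.theta s y * E.kernel (u - v) z y)) = E.trans y u x := by
  set r := G.rate s x
  set δ : ℝ := if x = y then 1 else 0
  have hθ := (G.theta_pos s x).ne'
  have hr : r ≠ 0 := (G.rate_pos s x).ne'
  have hc : ∀ z, Continuous fun v => E.kernel (u - v) z y := fun z =>
    (E.continuous_kernel z y).comp (continuous_const.sub continuous_id)
  have hi1 : IntervalIntegrable (fun v => r * Real.exp (-(r * v)) * 1) volume 0 u :=
    Continuous.intervalIntegrable (by fun_prop) _ _
  have hi2 : ∀ z ∈ D, IntervalIntegrable (fun v => r * Real.exp (-(r * v)) *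
      (G.theta s y * E.kernel (u - v) z y)) volume 0 u := fun z _ =>
    Continuous.intervalIntegrable (by have := hc z; fun_prop) _ _
  -- An explicit antiderivative of the difference of the two integrands. It vanishes at `v = u`,
  -- where the kernel is at its initial value, and at `v = 0` it is the transition function minus
  -- `δ`.
  have hder : ∀ v ∈ uIcc 0 u, HasDerivAt
      (fun v => Real.exp (-(r * v)) * (G.theta s y * E.kernel (u - v) x y - δ))
      (δ * (r * Real.exp (-(r * v)) * 1) - ∑ z ∈ D, G.weight x z / G.pi x *
        (r * Real.exp (-(r * v)) * (G.theta s y * E.kernel (u - v) z y))) v := by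
    intro v _
    have h1 : HasDerivAt (fun v => Real.exp (-(r * v))) (Real.exp (-(r * v)) * (-(r * 1))) v :=
      (((hasDerivAt_id v).const_mul r).neg).exp
    have h2 : HasDerivAt (fun v => E.kernel (u - v) x y) (E.kernelDeriv (u - v) x y * -1) v :=
      (E.hasDerivAt_kernel (u - v) x y).comp v ((hasDerivAt_id v).const_sub u)
    refine (h1.mul ((h2.const_mul (G.theta s y)).sub_const δ)).congr_deriv ?_
    rw [E.kernelDeriv_eq _ hx]
    have h3 : ∑ z ∈ D, G.weight x z / G.pi x *
        (r * Real.exp (-(r * v)) * (G.theta s y * E.kernel (u - v) z y)) =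
        Real.exp (-(r * v)) * G.theta s y *
          ((G.theta s x)⁻¹ * ∑ z ∈ D, E.kernel (u - v) z y * G.weight x z) := by
      rw [Finset.mul_sum, Finset.mul_sum]
      refine Finset.sum_congr rfl fun z _ => ?_
      rw [← G.theta_mul_rate s x]
      change G.weight x z / (G.theta s x * r) * _ = _
      field_simp
    rw [h3]
    ring
  have hi3 : IntervalIntegrable (fun v => ∑ z ∈ D, G.weight x z / G.pi x *
      (r * Real.exp (-(r * v)) * (G.theta s y * E.kernel (u - v) z y))) volume 0 u :=
    Continuous.intervalIntegrable (continuous_finsetSum D fun z _ => by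
      have := hc z; fun_prop) _ _
  have h := intervalIntegral.integral_eq_sub_of_hasDerivAt hder ((hi1.const_mul δ).sub hi3)
  rw [intervalIntegral.integral_sub (hi1.const_mul δ) hi3,
    intervalIntegral.integral_const_mul,
    intervalIntegral.integral_finsetSum fun z hz => (hi2 z hz).const_mul _] at h
  simp_rw [intervalIntegral.integral_const_mul] at h ⊢
  have h0 : G.theta s y * E.kernel 0 x y = δ := by
    rw [E.kernel_zero hx hy]
    by_cases hxy : x = y
    · subst hxy; simp [δ, hθ]
    · simp [δ, hxy]
  rw [sub_self, h0, sub_self, mul_zero, mul_zero, neg_zero, Real.exp_zero, one_mul, sub_zero] at h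
  rw [trans, if_pos hu]
  linarith

open Classical in
/-- The transition function evaluated after `n` jumps, on the event that the walk has stayed
in `D`. -/
noncomputable def remainder (t : ℝ) (y : V) (n : ℕ) (w : Path V) : ℝ :=
  if ∀ i ≤ n, (w i).1 ∈ D then E.trans y (t - jumpTime w n) (w n).1 else 0

lemma abs_remainder_le (t : ℝ) (y : V) (n : ℕ) (w : Path V) :
    |E.remainder t y n w| ≤ G.theta s y * E.bound y := by
  unfold remainder
  split_ifs
  · exact E.abs_trans_le _ _ _
  · rw [abs_zero]
    exact mul_nonneg (G.theta_pos s y).le (E.bound_nonneg y)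

end Eigenbasis

open Classical in
lemma integral_jump_indicator [MeasurableSpace V] [DiscreteMeasurableSpace V]
    (G : WeightedGraph V M) (x z : V) :
    ∫ a, (if a = z then (1 : ℝ) else 0) ∂(G.jump x).toMeasure = G.weight x z / G.pi x := by
  have h : (fun a => if a = z then (1 : ℝ) else 0) = indicator {z} 1 := by
    ext a; simp [indicator_apply]
  rw [h, integral_indicator_one (MeasurableSet.of_discrete), measureReal_def,
    PMF.toMeasure_apply_singleton _ _ (MeasurableSet.of_discrete)]
  exact ENNReal.toReal_ofReal (div_nonneg (G.nonneg x z) (G.pi_pos x).le)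

/-- Rates may be unbounded on the whole graph, but on a finite set the ratios stay below a constant
less than one. -/
lemma exists_rate_ratio (G : WeightedGraph V M) (s : Speed) (D : Finset V) :
    ∃ κ : ℝ, 0 ≤ κ ∧ κ < 1 ∧ ∀ z ∈ D, G.rate s z / (G.rate s z + 1) ≤ κ := by
  have hr := G.rate_pos s
  have h1 : ∀ z, G.rate s z / (G.rate s z + 1) < 1 := fun z => by
    have := hr z
    rw [div_lt_one (by linarith)]; linarith
  rcases D.eq_empty_or_nonempty with rfl | hD
  · exact ⟨0, le_rfl, one_pos, by simp⟩
  · obtain ⟨z, hz, hmax⟩ := D.exists_max_image (fun z => G.rate s z / (G.rate s z + 1)) hD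
    exact ⟨_, div_nonneg (hr z).le (by linarith [hr z]), h1 z, hmax⟩

end WeightedGraph
end RandomWalk

namespace RandomWalk
namespace WeightedGraph

variable {V : Type*} {M : ℕ} [Countable V] [MeasurableSpace V] [DiscreteMeasurableSpace V]
  {G : WeightedGraph V M} {s : Speed} {D : Finset V}

/-! ### Identification of the Dirichlet heat kernel -/

namespace Eigenbasis

variable (E : G.Eigenbasis s D)

lemma measurable_trans_prod (y : V) : Measurable fun p : ℝ × V => E.trans y p.1 p.2 :=
  measurable_from_prod_countable_left fun z => E.measurable_trans y z

open Classical in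
-- First-jump analysis: either the holding time exceeds `u` and the walk is still at `x`, or it
-- jumps earlier and starts afresh with the remaining time. For negative `u` both terms vanish
-- almost surely.
lemma integral_step_trans {x y : V} (hx : x ∈ D) (hy : y ∈ D) (u : ℝ) :
    ∫ a, ((if x = y ∧ 0 ≤ u ∧ u < a.2 then 1 else 0) + E.trans y (u - a.2) a.1) ∂(G.step s x) =
      E.trans y u x := by
  rcases lt_or_ge u 0 with hu | hu
  · rw [integral_eq_zero_of_ae]
    · rw [trans, if_neg (not_le.2 hu)]
    · filter_upwards [G.ae_step_pos s x] with a ha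
      have h1 : ¬ 0 ≤ u - a.2 := by linarith
      have h2 : ¬ 0 ≤ u := by linarith
      simp [trans, h1, h2]
  have hprob := isProbabilityMeasure_expMeasure (G.rate_pos s x)
  have hm1 : Measurable fun a : V × ℝ => if a.2 ≤ u then (1 : ℝ) else 0 :=
    Measurable.ite (measurableSet_le measurable_snd measurable_const) measurable_const
      measurable_const
  have hi1 : Integrable (fun a : V × ℝ => if a.2 ≤ u then (1 : ℝ) else 0) (G.step s x) :=
    Integrable.of_bound hm1.aestronglyMeasurable 1 (Filter.Eventually.of_forall fun a => by
      split_ifs <;> simp)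
  have hi2 : ∀ z ∈ D, Integrable (fun a : V × ℝ => (if a.1 = z then (1 : ℝ) else 0) *
      E.trans y (u - a.2) z) (G.step s x) := by
    intro z _
    refine Integrable.of_bound (C := G.theta s y * E.bound y)
      (Measurable.aestronglyMeasurable ?_) (Filter.Eventually.of_forall fun a => ?_)
    · refine Measurable.mul (Measurable.ite ?_ measurable_const measurable_const)
        ((E.measurable_trans y z).comp (measurable_const.sub measurable_snd))
      exact measurable_fst (MeasurableSet.of_discrete (s := {z}))
    · have := E.abs_trans_le y (u - a.2) z
      have h0 := (abs_nonneg _).trans this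
      split_ifs <;> simpa
  have hsplit : ∀ a : V × ℝ,
      ((if x = y ∧ 0 ≤ u ∧ u < a.2 then (1 : ℝ) else 0) + E.trans y (u - a.2) a.1) =
      (if x = y then (1 : ℝ) else 0) * (1 - if a.2 ≤ u then 1 else 0) +
        ∑ z ∈ D, (if a.1 = z then (1 : ℝ) else 0) * E.trans y (u - a.2) z := by
    intro a
    congr 1
    · by_cases h1 : x = y <;> by_cases h2 : a.2 ≤ u <;> simp [h1, h2, hu, not_lt.2, not_le.1]
    · simp only [ite_mul, one_mul, zero_mul, Finset.sum_ite_eq]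
      split_ifs with h
      · rfl
      · exact E.trans_off y _ h
  simp_rw [hsplit]
  have hi3 : Integrable (fun a : V × ℝ => (1 : ℝ) - if a.2 ≤ u then 1 else 0) (G.step s x) :=
    (integrable_const 1).sub hi1
  rw [integral_add (hi3.const_mul _) (integrable_finsetSum D hi2), integral_const_mul, integral_sub (integrable_const 1) hi1, integral_finsetSum D hi2,
    integral_const, probReal_univ, one_smul, ← E.backward_equation hx hy hu]
  have hfst : ∫ a : V × ℝ, (if a.2 ≤ u then (1 : ℝ) else 0) ∂(G.step s x) =
      ∫ v in (0 : ℝ)..u, G.rate s x * Real.exp (-(G.rate s x * v)) * 1 := by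
    rw [← integral_expMeasure_Iic (G.rate_pos s x) hu (fun _ => 1), step_apply]
    have := integral_prod_mul (μ := (G.jump x).toMeasure) (ν := expMeasure (G.rate s x))
      (fun _ => (1 : ℝ)) (fun v => if v ≤ u then (1 : ℝ) else 0)
    simpa using this
  rw [hfst]
  congr 1
  refine Finset.sum_congr rfl fun z _ => ?_
  rw [← integral_expMeasure_Iic (G.rate_pos s x) hu, step_apply,
    integral_prod_mul (fun a => if a = z then (1 : ℝ) else 0) (fun v => E.trans y (u - v) z),
    integral_jump_indicator]
  congr 1
  refine integral_congr_ae (Filter.Eventually.of_forall fun v => ?_)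
  simp [trans]

lemma measurable_remainder (t : ℝ) (y : V) (n : ℕ) : Measurable (E.remainder t y n) := by
  refine Measurable.ite (measurableSet_alive (D : Set V) n) ?_ measurable_const
  exact (E.measurable_trans_prod y).comp ((measurable_const.sub (measurable_jumpTime n)).prodMk
    (measurable_fst.comp (measurable_pi_apply n)))

/-- One application of the first-jump identity after `n` jumps, by the Markov property: either time
`t` falls before the next jump, which is the occupation event, or another jump is made. -/
lemma integral_remainder (t : ℝ) (x : V) {y : V} (hy : y ∈ D) (n : ℕ) :
    ∫ w, E.remainder t y n w ∂(G.law s x) =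
      (G.law s x).real (occupation D t y n) + ∫ w, E.remainder t y (n + 1) w ∂(G.law s x) := by
  classical
  let Φ : Path V → V × ℝ → ℝ := fun w a =>
    if ∀ i ≤ n, (w i).1 ∈ D then
      (if (w n).1 = y ∧ 0 ≤ t - jumpTime w n ∧ t - jumpTime w n < a.2 then 1 else 0) +
        E.trans y (t - jumpTime w n - a.2) a.1
    else 0
  have hT : Measurable fun p : Path V × (V × ℝ) => t - jumpTime p.1 n :=
    measurable_const.sub ((measurable_jumpTime n).comp measurable_fst)
  have hr : Measurable fun p : Path V × (V × ℝ) => p.2.2 := measurable_snd.comp measurable_snd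
  have hΦ : Measurable Φ.uncurry := by
    refine Measurable.ite (measurable_fst (measurableSet_alive (D : Set V) n))
      (Measurable.add (Measurable.ite ?_ measurable_const measurable_const) ?_) measurable_const
    · refine MeasurableSet.inter ?_ (MeasurableSet.inter ?_ ?_)
      · exact (measurable_fst.comp ((measurable_pi_apply n).comp measurable_fst))
          (MeasurableSet.of_discrete (s := {y}))
      · exact measurableSet_le measurable_const hT
      · exact measurableSet_lt hT hr
    · exact (E.measurable_trans_prod y).comp
        ((hT.sub hr).prodMk (measurable_fst.comp measurable_snd))
  have hdep : ∀ w w' : Path V, (∀ i ≤ n, w i = w' i) → Φ w = Φ w' := by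
    intro w w' h
    have h1 : (∀ i ≤ n, (w i).1 ∈ D) ↔ ∀ i ≤ n, (w' i).1 ∈ D :=
      forall₂_congr fun i hi => by rw [h i hi]
    ext a
    simp only [Φ, h1, jumpTime_congr h, h n le_rfl]
  have hC : ∀ w a, |Φ w a| ≤ 1 + G.theta s y * E.bound y := by
    intro w a
    have h0 := mul_nonneg (G.theta_pos s y).le (E.bound_nonneg y)
    simp only [Φ]
    split_ifs
    · exact (abs_add_le _ _).trans (add_le_add (by simp) (E.abs_trans_le _ _ _))
    · exact (abs_add_le _ _).trans (add_le_add (by simp) (E.abs_trans_le _ _ _))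
    · rw [abs_zero]; linarith
  have key := G.integral_law_succ s x n hΦ hdep hC
  have h1 : ∀ w : Path V, ∫ a, Φ w a ∂(G.step s (w n).1) = E.remainder t y n w := by
    intro w
    simp only [Φ, remainder]
    split_ifs with hw
    · exact E.integral_step_trans (hw n le_rfl) hy _
    · simp
  -- A jump out of `D` needs no separate term, since the transition function vanishes off `D`.
  have h2 : ∀ w : Path V, Φ w (w (n + 1)) =
      indicator (occupation (D : Set V) t y n) 1 w + E.remainder t y (n + 1) w := by
    intro w
    have hT' : t - jumpTime w n - (w (n + 1)).2 = t - jumpTime w (n + 1) := by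
      rw [jumpTime_succ]; ring
    have hocc : w ∈ occupation (D : Set V) t y n ↔ (∀ i ≤ n, (w i).1 ∈ D) ∧
        ((w n).1 = y ∧ 0 ≤ t - jumpTime w n ∧ t - jumpTime w n < (w (n + 1)).2) := by
      simp only [occupation, mem_ofPred_eq, jumpTime_succ, sub_nonneg, sub_lt_iff_lt_add',
        Finset.mem_coe]
    simp only [Φ, remainder, indicator_apply, hocc, hT', Pi.one_apply]
    by_cases hw : ∀ i ≤ n, (w i).1 ∈ D
    · by_cases hn : (w (n + 1)).1 ∈ D
      · have : ∀ i ≤ n + 1, (w i).1 ∈ D := fun i hi => by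
          rcases Nat.le_succ_iff.1 hi with h | h
          · exact hw i h
          · rwa [h]
        simp only [if_pos hw, if_pos this, and_iff_right hw]
      · have : ¬ ∀ i ≤ n + 1, (w i).1 ∈ D := fun h => hn (h _ le_rfl)
        simp only [if_pos hw, if_neg this, E.trans_off y _ hn, and_iff_right hw]
    · have : ¬ ∀ i ≤ n + 1, (w i).1 ∈ D := fun h => hw fun i hi => h i (by omega)
      simp [hw, this]
  simp_rw [h1, h2] at key
  rw [← key, integral_add, integral_indicator_one (measurableSet_occupation _ _ _ _)]
  · exact (integrable_const (1 : ℝ)).indicator (measurableSet_occupation _ _ _ _)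
  · exact Integrable.of_bound (E.measurable_remainder t y (n + 1)).aestronglyMeasurable _
      (Filter.Eventually.of_forall fun w => E.abs_remainder_le t y (n + 1) w)

end Eigenbasis

/-- The probability of many jumps in bounded time inside a finite set. -/
lemma lintegral_exp_neg_jumpTime_le (G : WeightedGraph V M) (s : Speed) (D : Finset V) {κ : ℝ}
    (hκ : ∀ z ∈ D, G.rate s z / (G.rate s z + 1) ≤ κ) (x : V) (n : ℕ) :
    ∫⁻ w, {w : Path V | ∀ i ≤ n, (w i).1 ∈ D}.indicator
      (fun w => ENNReal.ofReal (Real.exp (-jumpTime w n))) w ∂(G.law s x) ≤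
        ENNReal.ofReal κ ^ n := by
  classical
  have hmT : ∀ n, Measurable fun w : Path V => ENNReal.ofReal (Real.exp (-jumpTime w n)) :=
    fun n => (Real.measurable_exp.comp (measurable_jumpTime n).neg).ennreal_ofReal
  induction n with
  | zero =>
    rw [pow_zero, ← measure_univ (μ := G.law s x), ← lintegral_one]
    refine lintegral_mono fun w => indicator_apply_le' (fun _ => ?_) fun _ => zero_le
    simp [jumpTime_zero]
  | succ n ih =>
    let F : Path V → ℝ≥0∞ := {w : Path V | ∀ i ≤ n, (w i).1 ∈ D}.indicator
      (fun w => ENNReal.ofReal (Real.exp (-jumpTime w n)))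
    have hF : Measurable F := (hmT n).indicator (measurableSet_alive (D : Set V) n)
    let Φ : Path V → V × ℝ → ℝ≥0∞ := fun w a => F w * ENNReal.ofReal (Real.exp (-a.2))
    have hm : Measurable fun u : ℝ => ENNReal.ofReal (Real.exp (-u)) := by fun_prop
    have hΦ : Measurable Φ.uncurry :=
      (hF.comp measurable_fst).mul (hm.comp (measurable_snd.comp measurable_snd))
    have hdep : ∀ w w' : Path V, (∀ i ≤ n, w i = w' i) → Φ w = Φ w' := by
      intro w w' h
      have h1 : (∀ i ≤ n, (w i).1 ∈ D) ↔ ∀ i ≤ n, (w' i).1 ∈ D :=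
        forall₂_congr fun i hi => by rw [h i hi]
      ext a
      simp only [Φ, F, indicator_apply, mem_ofPred_eq, h1, jumpTime_congr h]
    have key := G.lintegral_law_succ s x n hΦ hdep
    calc _ ≤ ∫⁻ w, Φ w (w (n + 1)) ∂(G.law s x) := by
          refine lintegral_mono fun w => indicator_apply_le' (fun hw => ?_) fun _ => zero_le
          have hw' : w ∈ {w : Path V | ∀ i ≤ n, (w i).1 ∈ D} := fun i hi => hw i (by omega)
          simp only [Φ, F]
          rw [indicator_of_mem hw', ← ENNReal.ofReal_mul (Real.exp_pos _).le, ← Real.exp_add,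
            jumpTime_succ, neg_add]
      _ = ∫⁻ w, ∫⁻ a, Φ w a ∂(G.step s (w n).1) ∂(G.law s x) := key
      _ ≤ ∫⁻ w, F w * ENNReal.ofReal κ ∂(G.law s x) := by
          refine lintegral_mono fun w => ?_
          simp only [Φ]
          rw [lintegral_const_mul _ (by exact hm.comp measurable_snd)]
          by_cases hw : w ∈ {w : Path V | ∀ i ≤ n, (w i).1 ∈ D}
          · gcongr
            have hprob := isProbabilityMeasure_expMeasure (G.rate_pos s (w n).1)
            have := lintegral_prod_mul (μ := (G.jump (w n).1).toMeasure)
              (ν := expMeasure (G.rate s (w n).1)) (f := fun _ => 1) aemeasurable_const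
              hm.aemeasurable
            simp only [one_mul, lintegral_one, measure_univ] at this
            rw [step_apply, this, lintegral_exp_neg_expMeasure (G.rate_pos s _)]
            exact ENNReal.ofReal_le_ofReal (hκ _ (hw n le_rfl))
          · simp only [F]
            rw [indicator_of_notMem hw]
            simp
      _ = (∫⁻ w, F w ∂(G.law s x)) * ENNReal.ofReal κ := lintegral_mul_const _ hF
      _ ≤ ENNReal.ofReal κ ^ (n + 1) := by
          rw [pow_succ]
          gcongr

namespace Eigenbasis

variable (E : G.Eigenbasis s D)

open Filter Topology

/-- A Chernoff bound: the remainder is nonzero only if the walk has stayed in `D` and `jumpTime w n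
≤ t`, and there `1 ≤ exp (t - jumpTime w n)`. The expectation is therefore at most a constant times
`κ ^ n`. -/
lemma tendsto_integral_remainder (t : ℝ) (x y : V) :
    Tendsto (fun n => ∫ w, E.remainder t y n w ∂(G.law s x)) atTop (𝓝 0) := by
  obtain ⟨κ, hκ0, hκ1, hκ⟩ := exists_rate_ratio G s D
  set C := G.theta s y * E.bound y
  have hC : 0 ≤ C := mul_nonneg (G.theta_pos s y).le (E.bound_nonneg y)
  have hle : ∀ n, |∫ w, E.remainder t y n w ∂(G.law s x)| ≤ C * Real.exp t * κ ^ n := by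
    intro n
    have h1 : ∫⁻ w, ENNReal.ofReal ‖E.remainder t y n w‖ ∂(G.law s x) ≤
        ENNReal.ofReal (C * Real.exp t * κ ^ n) := by
      calc _ ≤ ∫⁻ w, ENNReal.ofReal (C * Real.exp t) *
            {w : Path V | ∀ i ≤ n, (w i).1 ∈ D}.indicator
              (fun w => ENNReal.ofReal (Real.exp (-jumpTime w n))) w ∂(G.law s x) := by
            refine lintegral_mono fun w => ?_
            by_cases hw : ∀ i ≤ n, (w i).1 ∈ D
            · by_cases ht : 0 ≤ t - jumpTime w n
              · rw [indicator_of_mem (by exact hw), ← ENNReal.ofReal_mul (by positivity)]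
                refine ENNReal.ofReal_le_ofReal ((E.abs_remainder_le t y n w).trans ?_)
                rw [mul_assoc, ← Real.exp_add]
                exact le_mul_of_one_le_right hC (Real.one_le_exp (by linarith))
              · simp [remainder, trans, ht]
            · simp [remainder, hw]
        _ = ENNReal.ofReal (C * Real.exp t) * ∫⁻ w,
            {w : Path V | ∀ i ≤ n, (w i).1 ∈ D}.indicator
              (fun w => ENNReal.ofReal (Real.exp (-jumpTime w n))) w ∂(G.law s x) :=
            lintegral_const_mul' _ _ ENNReal.ofReal_ne_top
        _ ≤ ENNReal.ofReal (C * Real.exp t) * ENNReal.ofReal κ ^ n := by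
            gcongr
            exact lintegral_exp_neg_jumpTime_le G s D hκ x n
        _ = _ := by
            rw [← ENNReal.ofReal_pow hκ0, ← ENNReal.ofReal_mul (by positivity)]
    have h2 := ENNReal.toReal_mono ENNReal.ofReal_ne_top h1
    rw [ENNReal.toReal_ofReal (by positivity)] at h2
    exact (norm_integral_le_lintegral_norm _).trans h2
  refine squeeze_zero_norm hle ?_
  have := (tendsto_pow_atTop_nhds_zero_of_lt_one hκ0 hκ1).const_mul (C * Real.exp t)
  rwa [mul_zero] at this

/-- The killed event splits, up to null sets, into disjoint events according to the number of jumps.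
Their probabilities telescope through `integral_remainder`: the remainder starts at the spectral
expression and tends to zero. -/
theorem prob_killed_eq {t : ℝ} (ht : 0 ≤ t) {x y : V} (hx : x ∈ D) (hy : y ∈ D) :
    (G.law s x).real {w | killed D w t = some y} = G.theta s y * E.kernel t x y := by
  have hpos := G.ae_holding_pos s x
  have h1 : (G.law s x) {w | killed D w t = some y} =
      (G.law s x) (⋃ n, occupation D t y n) := by
    refine measure_congr ?_
    filter_upwards [hpos] with w hw
    exact propext ((killed_eq_some_iff hw ht y).trans mem_iUnion.symm)
  have h2 : (G.law s x) (⋃ n, occupation D t y n) =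
      ∑' n, (G.law s x) (occupation D t y n) := by
    refine measure_iUnion₀ (fun m n hmn => ?_) fun n =>
      (measurableSet_occupation _ _ _ _).nullMeasurableSet
    refine measure_mono_null (fun w hw => ?_) (ae_iff.1 hpos)
    intro hw'
    exact hmn (jump_index_unique hw' hw.1.2.2.1 hw.1.2.2.2 hw.2.2.2.1 hw.2.2.2.2)
  have h3 : ∀ N, ∑ n ∈ Finset.range N, (G.law s x).real (occupation D t y n) =
      ∫ w, E.remainder t y 0 w ∂(G.law s x) - ∫ w, E.remainder t y N w ∂(G.law s x) := by
    intro N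
    induction N with
    | zero => simp
    | succ N ih =>
      rw [Finset.sum_range_succ, ih, E.integral_remainder t x hy N]; ring
  have h4 : ∫ w, E.remainder t y 0 w ∂(G.law s x) = G.theta s y * E.kernel t x y := by
    have : ∀ᵐ w ∂(G.law s x), E.remainder t y 0 w = G.theta s y * E.kernel t x y := by
      filter_upwards [G.law_zero_ae s x] with w hw
      simp [remainder, jumpTime_zero, hw, hx, trans, ht]
    rw [integral_congr_ae this]
    simp
  have h5 : HasSum (fun n => (G.law s x).real (occupation D t y n))
      (G.theta s y * E.kernel t x y) := by
    rw [hasSum_iff_tendsto_nat_of_nonneg fun n => measureReal_nonneg]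
    simp_rw [h3, h4]
    have := (E.tendsto_integral_remainder t x y).const_sub (G.theta s y * E.kernel t x y)
    rwa [sub_zero] at this
  rw [measureReal_def, h1, h2, ENNReal.tsum_toReal_eq fun n => measure_ne_top _ _]
  exact h5.tsum_eq

theorem dirichletHeatKernel_eq {t : ℝ} (ht : 0 ≤ t) {x y : V} (hx : x ∈ D) (hy : y ∈ D) :
    G.dirichletHeatKernel s D t x y = E.kernel t x y := by
  rw [dirichletHeatKernel, E.prob_killed_eq ht hx hy,
    mul_div_cancel_left₀ _ (G.theta_pos s y).ne']

end Eigenbasis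
end WeightedGraph
end RandomWalk

/-! ### Survival probabilities, mean exit times and the Poisson equation. -/

namespace RandomWalk

/-- A bound of the exit time by the number of lattice times before it. -/
lemma exitTime_le_tsum {V : Type*} (A : Set V) (w : WeightedGraph.Path V) {r T : ℝ} (hr : 0 ≤ r)
    (hT : 0 < T) : exitTime A w ≤ ENNReal.ofReal r +
      ∑' k : ℕ, {w | ENNReal.ofReal (r + k * T) < exitTime A w}.indicator
        (fun _ => ENNReal.ofReal T) w := by
  set τ := exitTime A w
  have key : ∀ N : ℕ, min τ (ENNReal.ofReal (r + N * T)) ≤ ENNReal.ofReal r +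
      ∑ k ∈ Finset.range N, {w | ENNReal.ofReal (r + k * T) < exitTime A w}.indicator
        (fun _ => ENNReal.ofReal T) w := by
    intro N
    induction N with
    | zero => simp
    | succ N ih =>
      rw [Finset.sum_range_succ, ← add_assoc]
      by_cases h : ENNReal.ofReal (r + N * T) < τ
      · rw [indicator_of_mem (by exact h)]
        rw [min_eq_right h.le] at ih
        refine (min_le_right _ _).trans (le_trans (le_of_eq ?_) (add_le_add_left ih _))
        rw [← ENNReal.ofReal_add (by positivity) hT.le]
        congr 1
        push_cast
        ring
      · rw [min_eq_left (not_lt.1 h)] at ih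
        exact (min_le_left _ _).trans (ih.trans le_self_add)
  -- The exit time may be infinite, so the bound is proved for every `c` below it; such a `c` is
  -- finite and lies below some lattice time.
  refine le_of_forall_lt_imp_le_of_dense fun c hc => ?_
  obtain ⟨N, hN⟩ := exists_nat_gt (c.toReal / T)
  have hcN : c ≤ ENNReal.ofReal (r + N * T) := by
    rw [← ENNReal.ofReal_toReal hc.ne_top]
    refine ENNReal.ofReal_le_ofReal ?_
    rw [div_lt_iff₀ hT] at hN
    linarith
  exact (le_min hc.le hcN).trans ((key N).trans (by gcongr; exact ENNReal.sum_le_tsum _))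

namespace WeightedGraph

variable {V : Type*} {M : ℕ} {G : WeightedGraph V M} {s : Speed} {D : Finset V}

namespace Eigenbasis

variable (E : G.Eigenbasis s D)

/-- The probability that the walk from `x` stays in `D` up to time `t`. -/
noncomputable def survival (t : ℝ) (x : V) : ℝ := ∑ y ∈ D, G.theta s y * E.kernel t x y

lemma sum_kernel_mul_survival (t u : ℝ) (x : V) :
    ∑ y ∈ D, G.theta s y * E.kernel t x y * E.survival u y = E.survival (t + u) x := by
  simp_rw [survival, Finset.mul_sum]
  rw [Finset.sum_comm]
  refine Finset.sum_congr rfl fun z _ => ?_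
  rw [← E.sum_kernel_mul_kernel, Finset.mul_sum]
  exact Finset.sum_congr rfl fun y _ => by ring

lemma sum_kernel_mul_fn (t : ℝ) (i : D) (x : V) :
    ∑ y ∈ D, G.theta s y * E.kernel t x y * E.fn i y = Real.exp (E.ev i * t) * E.fn i x := by
  have h : ∀ y, G.theta s y * E.kernel t x y * E.fn i y = ∑ j, Real.exp (E.ev j * t) * E.fn j x *
      (G.theta s y * (E.fn j y * E.fn i y)) := fun y => by
    simp only [kernel, spectralFn, Finset.mul_sum, Finset.sum_mul]
    exact Finset.sum_congr rfl fun j _ => by ring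
  simp_rw [h]
  rw [Finset.sum_comm]
  simp_rw [← Finset.mul_sum, E.orthonormal]
  simp

lemma hasDerivAt_spectralFn_exp (F : ℝ → ℝ) (t : ℝ) (x y : V) :
    HasDerivAt (fun t => E.spectralFn (fun u => Real.exp (u * t) * F u) x y)
      (E.spectralFn (fun u => Real.exp (u * t) * (u * F u)) x y) t := by
  unfold spectralFn
  refine HasDerivAt.fun_sum fun i _ => ?_
  have h := (((hasDerivAt_id t).const_mul (E.ev i)).exp.mul_const (F (E.ev i))).mul_const
    (E.fn i x * E.fn i y)
  refine h.congr_deriv ?_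
  simp only [id, mul_one]
  ring

section process

variable [Countable V] [MeasurableSpace V] [DiscreteMeasurableSpace V]

lemma kernel_nonneg {t : ℝ} (ht : 0 ≤ t) (x y : V) : 0 ≤ E.kernel t x y := by
  by_cases hx : x ∈ D
  · by_cases hy : y ∈ D
    · rw [← E.dirichletHeatKernel_eq ht hx hy]
      exact div_nonneg measureReal_nonneg (G.theta_pos s y).le
    · exact (E.spectralFn_off_right _ x hy).ge
  · exact (E.spectralFn_off_left _ hx y).ge

lemma kernel_le_heatKernel {t : ℝ} (ht : 0 ≤ t) {x y : V} (hx : x ∈ D) (hy : y ∈ D) :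
    E.kernel t x y ≤ G.heatKernel s t x y := by
  rw [← E.dirichletHeatKernel_eq ht hx hy]
  refine div_le_div_of_nonneg_right (measureReal_mono fun w hw => ?_) (G.theta_pos s y).le
  have hw' : killed (D : Set V) w t = some y := hw
  unfold killed at hw'
  split_ifs at hw'
  exact hw'

lemma survival_nonneg {t : ℝ} (ht : 0 ≤ t) (x : V) : 0 ≤ E.survival t x :=
  Finset.sum_nonneg fun y _ => mul_nonneg (G.theta_pos s y).le (E.kernel_nonneg ht x y)

lemma survival_le_one {t : ℝ} (ht : 0 ≤ t) (x : V) : E.survival t x ≤ 1 := by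
  by_cases hx : x ∈ D
  · have hae : ∀ y : V, {w | killed (D : Set V) w t = some y} =ᵐ[G.law s x]
        (⋃ n, occupation D t y n : Set (Path V)) := fun y => by
      filter_upwards [G.ae_holding_pos s x] with w hw
      exact propext ((killed_eq_some_iff hw ht y).trans mem_iUnion.symm)
    -- Measurability up to a null set suffices, and comes from almost sure equality with a union of
    -- occupation events.
    have hm : ∀ y ∈ D, NullMeasurableSet {w | killed (D : Set V) w t = some y} (G.law s x) :=
      fun y _ => (MeasurableSet.iUnion fun n =>
        measurableSet_occupation _ _ _ _).nullMeasurableSet.congr (hae y).symm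
    have hd : ((D : Set V)).Pairwise (Function.onFun (AEDisjoint (G.law s x))
        fun y => {w | killed (D : Set V) w t = some y}) := by
      intro y _ z _ hyz
      refine Disjoint.aedisjoint (disjoint_left.2 fun w hw hw' => hyz ?_)
      exact Option.some.inj ((hw : killed (D : Set V) w t = some y).symm.trans hw')
    have h := measure_biUnion_finset₀ hd hm
    have h2 : ∑ y ∈ D, (G.law s x) {w | killed (D : Set V) w t = some y} ≤ 1 :=
      h ▸ prob_le_one
    have h3 := ENNReal.toReal_mono ENNReal.one_ne_top h2
    rw [ENNReal.toReal_sum fun y _ => measure_ne_top _ _, ENNReal.toReal_one] at h3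
    refine le_trans (le_of_eq (Finset.sum_congr rfl fun y hy => ?_)) h3
    exact (E.prob_killed_eq ht hx hy).symm
  · refine le_trans (le_of_eq (Finset.sum_eq_zero fun y _ => ?_)) zero_le_one
    rw [show E.kernel t x y = 0 from E.spectralFn_off_left _ hx y, mul_zero]

lemma survival_add_mul_le {T : ℝ} (hT : 0 < T) (hS : ∀ x ∈ D, E.survival T x ≤ 1 / 2) {r : ℝ}
    (hr : 0 ≤ r) (x : V) (k : ℕ) : E.survival (r + k * T) x ≤ (1 / 2) ^ k * E.survival r x := by
  induction k with
  | zero => simp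
  | succ k ih =>
    have h : r + (k + 1 : ℕ) * T = (r + k * T) + T := by push_cast; ring
    have hk : 0 ≤ r + k * T := by positivity
    rw [h, ← E.sum_kernel_mul_survival]
    calc _ ≤ ∑ y ∈ D, G.theta s y * E.kernel (r + k * T) x y * (1 / 2) :=
          Finset.sum_le_sum fun y hy => mul_le_mul_of_nonneg_left (hS y hy)
            (mul_nonneg (G.theta_pos s y).le (E.kernel_nonneg hk x y))
      _ = E.survival (r + k * T) x * (1 / 2) := (Finset.sum_mul _ _ _).symm
      _ ≤ (1 / 2) ^ k * E.survival r x * (1 / 2) := by gcongr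
      _ = _ := by ring

/-- Each further period `T` at least halves the survival probability, so the sum over the lattice
times `r + k T` is dominated by a geometric series with total `2 T * survival r x`. -/
theorem meanExitTime_le {T : ℝ} (hT : 0 < T) (hS : ∀ x ∈ D, E.survival T x ≤ 1 / 2) {r : ℝ}
    (hr : 0 ≤ r) {x : V} (hx : x ∈ D) :
    G.meanExitTime s D x ≤ ENNReal.ofReal (r + 2 * T * E.survival r x) := by
  have hsurv := E.survival_nonneg hr x
  have hmeas : ∀ k : ℕ, (G.law s x) {w | ENNReal.ofReal (r + k * T) < exitTime (D : Set V) w} ≤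
      ENNReal.ofReal ((1 / 2) ^ k * E.survival r x) := by
    intro k
    have hk : 0 ≤ r + k * T := by positivity
    have hsub : {w | ENNReal.ofReal (r + k * T) < exitTime (D : Set V) w} ⊆
        ⋃ y ∈ D, {w | killed (D : Set V) w (r + k * T) = some y} := by
      intro w hw
      obtain ⟨y, hy, hpos⟩ := position_of_lt_exitTime hk hw
      refine mem_biUnion (x := y) hy ?_
      change killed (D : Set V) w (r + k * T) = some y
      rw [killed, if_pos (by exact hw), hpos]
    calc _ ≤ ∑ y ∈ D, (G.law s x) {w | killed (D : Set V) w (r + k * T) = some y} :=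
          (measure_mono hsub).trans (measure_biUnion_finset_le _ _)
      _ = ∑ y ∈ D, ENNReal.ofReal (G.theta s y * E.kernel (r + k * T) x y) :=
          Finset.sum_congr rfl fun y hy => by
            rw [← E.prob_killed_eq hk hx hy, ofReal_measureReal]
      _ = ENNReal.ofReal (E.survival (r + k * T) x) :=
          (ENNReal.ofReal_sum_of_nonneg fun y _ =>
            mul_nonneg (G.theta_pos s y).le (E.kernel_nonneg hk x y)).symm
      _ ≤ _ := ENNReal.ofReal_le_ofReal (E.survival_add_mul_le hT hS hr x k)
  have hgeom : HasSum (fun k : ℕ => T * ((1 / 2 : ℝ) ^ k * E.survival r x))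
      (2 * T * E.survival r x) := by
    rw [show 2 * T * E.survival r x = T * (2 * E.survival r x) by ring]
    exact (hasSum_geometric_two.mul_right (E.survival r x)).mul_left T
  -- Measurable hulls have the same measure as the events and allow the integral and the sum to be
  -- exchanged.
  let S : ℕ → Set (Path V) := fun k =>
    toMeasurable (G.law s x) {w | ENNReal.ofReal (r + k * T) < exitTime (D : Set V) w}
  have hSm : ∀ k, Measurable ((S k).indicator fun _ => ENNReal.ofReal T) := fun k =>
    measurable_const.indicator (measurableSet_toMeasurable _ _)
  calc G.meanExitTime s D x
      ≤ ∫⁻ w, (ENNReal.ofReal r + ∑' k, (S k).indicator (fun _ => ENNReal.ofReal T) w)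
          ∂(G.law s x) := by
        refine lintegral_mono fun w => (exitTime_le_tsum _ w hr hT).trans ?_
        gcongr with k
        exact subset_toMeasurable _ _
    _ = ENNReal.ofReal r + ∑' k, ENNReal.ofReal T * (G.law s x) (S k) := by
        rw [lintegral_add_left measurable_const, lintegral_const, measure_univ, mul_one,
          lintegral_tsum fun k => (hSm k).aemeasurable]
        congr 2
        ext k
        exact lintegral_indicator_const (measurableSet_toMeasurable _ _) _
    _ ≤ ENNReal.ofReal r + ∑' k : ℕ, ENNReal.ofReal (T * ((1 / 2) ^ k * E.survival r x)) := by
        gcongr with k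
        rw [measure_toMeasurable, ENNReal.ofReal_mul hT.le]
        gcongr
        exact hmeas k
    _ = ENNReal.ofReal (r + 2 * T * E.survival r x) := by
        rw [← ENNReal.ofReal_tsum_of_nonneg (fun k => by positivity) hgeom.summable,
          hgeom.tsum_eq, ← ENNReal.ofReal_add hr (by positivity)]

lemma abs_sum_kernel_mul_le {t : ℝ} (ht : 0 ≤ t) (x : V) {f : V → ℝ} {C : ℝ}
    (hf : ∀ y ∈ D, |f y| ≤ C) :
    |∑ y ∈ D, G.theta s y * E.kernel t x y * f y| ≤ E.survival t x * C := by
  refine (Finset.abs_sum_le_sum_abs _ _).trans ?_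
  rw [survival, Finset.sum_mul]
  refine Finset.sum_le_sum fun y hy => ?_
  have h := mul_nonneg (G.theta_pos s y).le (E.kernel_nonneg ht x y)
  rw [abs_mul, abs_of_nonneg h]
  exact mul_le_mul_of_nonneg_left (hf y hy) h

/-- An eigenfunction with eigenvalue zero would be fixed by the semigroup, which at time `T`
contracts the supremum norm by a factor `1 / 2`. -/
lemma ev_ne_zero {T : ℝ} (hT : 0 < T) (hS : ∀ x ∈ D, E.survival T x ≤ 1 / 2) (i : D) :
    E.ev i ≠ 0 := by
  intro h0
  obtain ⟨x, hx, hmax⟩ := D.exists_max_image (fun x => |E.fn i x|) ⟨i, i.2⟩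
  have h1 := E.abs_sum_kernel_mul_le hT.le x hmax
  rw [E.sum_kernel_mul_fn, h0, zero_mul, Real.exp_zero, one_mul] at h1
  have h2 : |E.fn i x| ≤ 0 := by
    nlinarith [mul_le_mul_of_nonneg_right (hS x hx) (abs_nonneg (E.fn i x))]
  have := E.orthonormal i i
  rw [if_pos rfl, Finset.sum_eq_zero fun y hy => by
    rw [abs_nonpos_iff.1 ((hmax y hy).trans h2)]; ring] at this
  exact zero_ne_one this

/-- Solution of the Poisson equation with zero boundary values. -/
theorem exists_poisson_solution {T : ℝ} (hT : 0 < T) (hS : ∀ x ∈ D, E.survival T x ≤ 1 / 2)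
    {f : V → ℝ} {C : ℝ} (hf : ∀ x ∈ D, |f x| ≤ C) (hC : 0 ≤ C) :
    ∃ g : V → ℝ, (∀ x ∈ D, G.laplace s g x = f x) ∧ ∀ x, |g x| ≤ 2 * T * C := by
  classical
  have hev := E.ev_ne_zero hT hS
  -- With `L` the Dirichlet Laplacian, this is `exp(tL) L⁻¹ f`, and the solution is `Φ 0`. Its time
  -- derivative `exp(tL) f` is at most `C`, and `Φ T = exp(TL) Φ 0` has at most half the supremum
  -- norm. So `sup |Φ 0| ≤ T C + sup |Φ 0| / 2`.
  let Φ : ℝ → V → ℝ := fun t x => ∑ y ∈ D, (G.theta s y * f y) *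
    E.spectralFn (fun u => Real.exp (u * t) * u⁻¹) x y
  have hderiv : ∀ t x, HasDerivAt (fun t => Φ t x)
      (∑ y ∈ D, G.theta s y * E.kernel t x y * f y) t := by
    intro t x
    refine (HasDerivAt.fun_sum fun y _ =>
      (E.hasDerivAt_spectralFn_exp (fun u => u⁻¹) t x y).const_mul
        (G.theta s y * f y)).congr_deriv (Finset.sum_congr rfl fun y _ => ?_)
    rw [kernel, E.spectralFn_congr (F' := fun u => Real.exp (u * t)) fun i => by
      rw [mul_inv_cancel₀ (hev i), mul_one]]
    ring
  have hsemi : ∀ x, ∑ y ∈ D, G.theta s y * E.kernel T x y * Φ 0 y = Φ T x := by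
    intro x
    simp only [Φ, Finset.mul_sum]
    rw [Finset.sum_comm]
    refine Finset.sum_congr rfl fun z _ => ?_
    have h1 := E.sum_spectralFn_mul (fun u => Real.exp (u * T))
      (fun u => Real.exp (u * 0) * u⁻¹) x z
    have h2 : E.spectralFn (fun u => Real.exp (u * T) * (Real.exp (u * 0) * u⁻¹)) x z =
        E.spectralFn (fun u => Real.exp (u * T) * u⁻¹) x z :=
      E.spectralFn_congr (fun i => by simp) x z
    rw [← h2, ← h1, Finset.mul_sum]
    exact Finset.sum_congr rfl fun y _ => by rw [kernel]; ring
  refine ⟨Φ 0, fun x hx => ?_, fun x => ?_⟩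
  · simp only [Φ]
    rw [laplace_sum]
    have h : ∀ y ∈ D, G.theta s y * f y * G.laplace s
        (fun x => E.spectralFn (fun u => Real.exp (u * 0) * u⁻¹) x y) x =
        G.theta s y * f y * if y = x then (G.theta s y)⁻¹ else 0 := by
      intro y hy
      simp_rw [fun x => E.spectralFn_comm (fun u => Real.exp (u * 0) * u⁻¹) x y]
      rw [E.laplace_spectralFn _ y hx, E.spectralFn_congr (F' := fun _ => 1) fun i => by
        simp [hev i], E.spectralFn_one hy hx fun _ => rfl]
    rw [Finset.sum_congr rfl h]
    have := (G.theta_pos s x).ne'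
    simp [hx]
    field_simp
  · rcases D.eq_empty_or_nonempty with rfl | hD
    · simp [Φ]; positivity
    obtain ⟨z, hz, hmax⟩ := D.exists_max_image (fun x => |Φ 0 x|) hD
    have hle : |Φ 0 x| ≤ |Φ 0 z| := by
      by_cases hx : x ∈ D
      · exact hmax x hx
      · have : Φ 0 x = 0 := Finset.sum_eq_zero fun y _ => by
          rw [E.spectralFn_off_left _ hx, mul_zero]
        rw [this, abs_zero]; exact abs_nonneg _
    have h1 := norm_image_sub_le_of_norm_deriv_le_segment' (a := 0) (b := T) (C := C)
      (f := fun t => Φ t z) (fun t _ => (hderiv t z).hasDerivWithinAt)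
      (fun t ht => (E.abs_sum_kernel_mul_le ht.1 z hf).trans
        (mul_le_of_le_one_left hC (E.survival_le_one ht.1 z))) T ⟨hT.le, le_rfl⟩
    have h2 := E.abs_sum_kernel_mul_le hT.le z hmax
    rw [hsemi] at h2
    rw [Real.norm_eq_abs, sub_zero] at h1
    have h3 := abs_sub_abs_le_abs_sub (Φ 0 z) (Φ T z)
    rw [abs_sub_comm] at h3
    have h4 := mul_le_mul_of_nonneg_right (hS z hz) (abs_nonneg (Φ 0 z))
    linarith

end process
end Eigenbasis
end WeightedGraph
end RandomWalk

namespace RandomWalk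
namespace WeightedGraph

variable {V : Type*} {M : ℕ} {G : WeightedGraph V M} {s : Speed}

/-! ### Oscillation of harmonic functions -/

/-- The elliptic Harnack inequality with constant `C` in the balls around `x₀` with radius at
least `R₁`. -/
def EllipticHarnack (G : WeightedGraph V M) (s : Speed) (x₀ : V) (C R₁ : ℝ) : Prop :=
  ∀ R, R₁ ≤ R → ∀ h : V → ℝ,
    (∀ x ∈ G.closure (G.ball x₀ R), 0 < h x) → (∀ x ∈ G.ball x₀ R, G.laplace s h x = 0) →
      ∀ x ∈ G.ball x₀ (R / 2), ∀ y ∈ G.ball x₀ (R / 2), h x ≤ C * h y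

/-- Adding a constant `ε > 0` preserves harmonicity and makes the function strictly positive; then
`ε` tends to zero. -/
lemma EllipticHarnack.le_of_nonneg {x₀ : V} {C R₁ R : ℝ} (H : G.EllipticHarnack s x₀ C R₁)
    (hR : R₁ ≤ R) {h : V → ℝ} (hpos : ∀ x ∈ G.closure (G.ball x₀ R), 0 ≤ h x)
    (hharm : ∀ x ∈ G.ball x₀ R, G.laplace s h x = 0) {x y : V} (hx : x ∈ G.ball x₀ (R / 2))
    (hy : y ∈ G.ball x₀ (R / 2)) : h x ≤ C * h y := by
  have key : ∀ ε : ℝ, 0 < ε → h x + ε ≤ C * (h y + ε) := fun ε hε =>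
    H R hR (fun z => h z + ε) (fun z hz => by linarith [hpos z hz])
      (fun z hz => by rw [laplace_add_const]; exact hharm z hz) x hx y hy
  have h1 : Filter.Tendsto (fun ε : ℝ => h x + ε) (nhdsWithin 0 (Ioi 0)) (nhds (h x + 0)) :=
    (Continuous.tendsto (by fun_prop) 0).mono_left nhdsWithin_le_nhds
  have h2 : Filter.Tendsto (fun ε : ℝ => C * (h y + ε)) (nhdsWithin 0 (Ioi 0))
      (nhds (C * (h y + 0))) :=
    (Continuous.tendsto (by fun_prop) 0).mono_left nhdsWithin_le_nhds
  have := le_of_tendsto_of_tendsto h1 h2 (Filter.eventually_of_mem self_mem_nhdsWithin key)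
  simpa using this

/-- The oscillation in `B(x₀, r / 4)` is smaller than the oscillation in `B(x₀, r)` by a constant
factor. -/
lemma EllipticHarnack.oscillation_quarter {x₀ : V} {C R₁ r w : ℝ}
    (H : G.EllipticHarnack s x₀ C R₁) (hC : 1 ≤ C) (hr : 2 * R₁ ≤ r) (hr2 : 2 ≤ r)
    {h : V → ℝ} (hharm : ∀ x ∈ G.ball x₀ r, G.laplace s h x = 0)
    (hosc : ∀ x ∈ G.ball x₀ r, ∀ y ∈ G.ball x₀ r, h x - h y ≤ w) :
    ∀ x ∈ G.ball x₀ (r / 4), ∀ y ∈ G.ball x₀ (r / 4), h x - h y ≤ (C - 1) / (C + 1) * w := by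
  have hne : (G.finite_ball x₀ r).toFinset.Nonempty :=
    ⟨x₀, by simpa using G.mem_ball_self x₀ (by linarith)⟩
  obtain ⟨a, ha, hmin⟩ := Finset.exists_min_image _ h hne
  obtain ⟨b, hb, hmax⟩ := Finset.exists_max_image _ h hne
  simp only [Finite.mem_toFinset] at ha hmin hb hmax
  -- Taking neighbours enlarges the radius by at most one, and `r / 2 + 1 ≤ r`.
  have hsub : G.closure (G.ball x₀ (r / 2)) ⊆ G.ball x₀ r :=
    (G.closure_ball_subset x₀ _).trans (G.ball_mono x₀ (by linarith))
  have hsub' : G.ball x₀ (r / 2) ⊆ G.ball x₀ r := G.ball_mono x₀ (by linarith)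
  intro x hx y hy
  have hq : r / 2 / 2 = r / 4 := by ring
  -- Harnack for `h - min h` and, with `x` and `y` exchanged, for `max h - h`. Adding the two gives
  -- `(C + 1) (h x - h y) ≤ (C - 1) (max h - min h)`.
  have h1 := H.le_of_nonneg (R := r / 2) (by linarith) (h := fun z => h z + -h a)
    (fun z hz => by linarith [hmin z (hsub hz)])
    (fun z hz => by rw [laplace_add_const]; exact hharm z (hsub' hz)) (by rwa [hq]) (by rwa [hq])
    (x := x) (y := y)
  have h2 := H.le_of_nonneg (R := r / 2) (by linarith) (h := fun z => -h z + h b)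
    (fun z hz => by linarith [hmax z (hsub hz)])
    (fun z hz => by
      rw [G.laplace_add_const s (fun z => -h z), laplace_neg, hharm z (hsub' hz), neg_zero])
    (by rwa [hq]) (by rwa [hq]) (x := y) (y := x)
  have h3 := hosc b hb a ha
  rw [div_mul_eq_mul_div, le_div_iff₀ (by linarith)]
  nlinarith [mul_le_mul_of_nonneg_left h3 (sub_nonneg.2 hC)]

theorem EllipticHarnack.oscillation {x₀ : V} {C R₁ r w : ℝ}
    (H : G.EllipticHarnack s x₀ C R₁) (hC : 1 ≤ C) (hR₁ : 1 ≤ R₁) {m : ℕ}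
    (hr : 2 * R₁ * 4 ^ m ≤ r) {h : V → ℝ} (hharm : ∀ x ∈ G.ball x₀ r, G.laplace s h x = 0)
    (hosc : ∀ x ∈ G.ball x₀ r, ∀ y ∈ G.ball x₀ r, h x - h y ≤ w) :
    ∀ x ∈ G.ball x₀ (r / 4 ^ m), ∀ y ∈ G.ball x₀ (r / 4 ^ m),
      h x - h y ≤ ((C - 1) / (C + 1)) ^ m * w := by
  induction m with
  | zero => simpa using hosc
  | succ m ih =>
    have h4 : (0 : ℝ) < 4 ^ m := by positivity
    have hr' : 2 * R₁ * 4 ≤ r / 4 ^ m := by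
      rw [le_div_iff₀ h4]
      calc _ = 2 * R₁ * 4 ^ (m + 1) := by ring
        _ ≤ r := hr
    have hrm : 2 * R₁ * 4 ^ m ≤ r := by
      rw [le_div_iff₀ h4] at hr'
      nlinarith
    have hsub : G.ball x₀ (r / 4 ^ m) ⊆ G.ball x₀ r :=
      G.ball_mono x₀ (div_le_self (by nlinarith) (one_le_pow₀ (by norm_num)))
    have := H.oscillation_quarter hC (by linarith) (by linarith)
      (fun x hx => hharm x (hsub hx)) (ih hrm)
    rwa [div_div, ← pow_succ, ← mul_assoc, ← pow_succ'] at this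

end WeightedGraph
end RandomWalk

namespace RandomWalk
namespace WeightedGraph

variable {V : Type*} {M : ℕ} {G : WeightedGraph V M} {s : Speed} {D : Finset V}

/-! ### Lower bounds of the Dirichlet heat kernel -/

namespace Eigenbasis

lemma abs_kernel_le (E : G.Eigenbasis s D) {t C : ℝ} (ht : 0 ≤ t) {x y : V}
    (hx : E.kernel (t / 2) x x ≤ C) (hy : E.kernel (t / 2) y y ≤ C) : |E.kernel t x y| ≤ C := by
  calc |E.kernel t x y|
      ≤ ∑ i, |Real.exp (E.ev i * t) * (E.fn i x * E.fn i y)| := Finset.abs_sum_le_sum_abs _ _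
    _ ≤ ∑ i, (1 / 2 * (Real.exp (E.ev i * (t / 2)) * (E.fn i x * E.fn i x)) +
          1 / 2 * (Real.exp (E.ev i * (t / 2)) * (E.fn i y * E.fn i y))) := by
        refine Finset.sum_le_sum fun i _ => ?_
        rw [abs_mul, abs_of_pos (Real.exp_pos _)]
        have h1 : |E.fn i x * E.fn i y| ≤
            (E.fn i x * E.fn i x + E.fn i y * E.fn i y) / 2 := by
          rw [abs_le]
          constructor <;> nlinarith [sq_nonneg (E.fn i x + E.fn i y),
            sq_nonneg (E.fn i x - E.fn i y)]
        have h2 : Real.exp (E.ev i * t) ≤ Real.exp (E.ev i * (t / 2)) := by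
          refine Real.exp_le_exp.2 ?_
          nlinarith [mul_nonneg (neg_nonneg.2 (E.ev_nonpos i)) ht]
        refine (mul_le_mul h2 h1 (abs_nonneg _) (Real.exp_pos _).le).trans (le_of_eq ?_)
        ring
    _ = 1 / 2 * E.kernel (t / 2) x x + 1 / 2 * E.kernel (t / 2) y y := by
        rw [Finset.sum_add_distrib, ← Finset.mul_sum, ← Finset.mul_sum]; rfl
    _ ≤ C := by linarith

/-- Cauchy–Schwarz in `ℓ²(θ)` for the kernel against the constant one; by symmetry and the semigroup
property, the squared norm of the kernel is its diagonal value at twice the time. -/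
lemma sq_survival_le (E : G.Eigenbasis s D) (t : ℝ) (x : V) :
    E.survival t x ^ 2 ≤ (∑ y ∈ D, G.theta s y) * E.kernel (t + t) x x := by
  rw [← E.sum_kernel_mul_kernel, survival]
  refine Finset.sum_sq_le_sum_mul_sum_of_sq_le_mul D (fun y _ => (G.theta_pos s y).le)
    (fun y _ => ?_) fun y _ => ?_
  · rw [E.kernel_comm t y x]
    exact mul_nonneg (G.theta_pos s y).le (mul_self_nonneg _)
  · rw [E.kernel_comm t y x]; exact le_of_eq (by ring)

variable [Countable V] [MeasurableSpace V] [DiscreteMeasurableSpace V] (E : G.Eigenbasis s D)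

/-- The oscillation of the kernel near `x₀`. -/
theorem kernel_sub_le {x₀ : V} {C R₁ R T τ C₀ ϑ : ℝ} {m : ℕ} (H : G.EllipticHarnack s x₀ C R₁)
    (hC : 1 ≤ C) (hR₁ : 1 ≤ R₁) (hR : 2 * R₁ * 4 ^ m ≤ R) {D' : Finset V}
    (hD' : (D' : Set V) = G.ball x₀ R) (hsub : D' ⊆ D) (E' : G.Eigenbasis s D')
    (hT : 0 < T) (hS : ∀ x ∈ D', E'.survival T x ≤ 1 / 2) (hτ : 0 < τ)
    (hC₀ : ∀ x ∈ D, E.kernel (τ / 2) x x ≤ C₀) (hϑ : T * (2 / τ) ≤ ϑ) {x y z : V} (hx : x ∈ D)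
    (hy : y ∈ G.ball x₀ (R / 4 ^ m)) (hz : z ∈ G.ball x₀ (R / 4 ^ m)) :
    E.kernel τ x y - E.kernel τ x z ≤
      4 * ϑ * C₀ + ((C - 1) / (C + 1)) ^ m * (2 * (C₀ + 2 * ϑ * C₀)) := by
  have hC₀' : 0 ≤ C₀ := (E.kernel_nonneg (by linarith) x x).trans (hC₀ x hx)
  have hmem : ∀ y, y ∈ D' ↔ y ∈ G.ball x₀ R := fun y => by rw [← hD']; rfl
  -- The Laplacian of `E.kernel τ x` is its time derivative, so subtracting this `g` leaves a
  -- function harmonic on the smaller ball.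
  obtain ⟨g, hg, hgle⟩ := E'.exists_poisson_solution hT hS
    (f := fun y => E.kernelDeriv τ x y) (C := 2 / τ * C₀)
    (fun y hy => E.abs_kernelDeriv_le hτ (hC₀ x hx) (hC₀ y (hsub hy))) (by positivity)
  have hgle' : ∀ y, |g y| ≤ 2 * ϑ * C₀ := fun y =>
    (hgle y).trans (by nlinarith [mul_le_mul_of_nonneg_right hϑ hC₀'])
  have hsub' : G.ball x₀ (R / 4 ^ m) ⊆ G.ball x₀ R := by
    have : (0 : ℝ) < 4 ^ m := by positivity
    exact G.ball_mono x₀ (div_le_self (by nlinarith) (one_le_pow₀ (by norm_num)))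
  have hu : ∀ y ∈ G.ball x₀ R, |E.kernel τ x y| ≤ C₀ := fun y hy =>
    E.abs_kernel_le hτ.le (hC₀ x hx) (hC₀ y (hsub ((hmem y).2 hy)))
  have h := H.oscillation hC hR₁ hR (h := fun y => E.kernel τ x y - g y)
    (w := 2 * (C₀ + 2 * ϑ * C₀))
    (fun y hy => by
      rw [laplace_sub, hg y ((hmem y).2 hy), E.laplace_kernel τ x (hsub ((hmem y).2 hy)),
        sub_self])
    (fun y hy z hz => by
      have h1 := abs_le.1 (hu y hy)
      have h2 := abs_le.1 (hu z hz)
      have h3 := abs_le.1 (hgle' y)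
      have h4 := abs_le.1 (hgle' z)
      linarith) y hy z hz
  have h3 := abs_le.1 (hgle' y)
  have h4 := abs_le.1 (hgle' z)
  linarith

/-- The mean exit time is at most `ℓ + 2 A r² * survival`. As `ℓ` is at most half of its lower bound
`b r²`, the survival term must supply the other half. -/
theorem le_survival {b A r ℓ : ℝ} {x : V} (hx : x ∈ D) (hA : 0 < A) (hr : 0 < r)
    (hexit : ENNReal.ofReal (b * r ^ 2) ≤ G.meanExitTime s D x)
    (hS : ∀ x ∈ D, E.survival (A * r ^ 2) x ≤ 1 / 2) (hℓ : 0 ≤ ℓ) (hℓb : ℓ ≤ b / 2 * r ^ 2) :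
    b / (4 * A) ≤ E.survival ℓ x := by
  have hT : 0 < A * r ^ 2 := by positivity
  have h := hexit.trans (E.meanExitTime_le hT hS hℓ hx)
  rw [ENNReal.ofReal_le_ofReal_iff (by
    have := E.survival_nonneg hℓ x; positivity)] at h
  rw [div_le_iff₀ (by positivity)]
  have hr2 : 0 < r ^ 2 := by positivity
  refine le_of_mul_le_mul_right ?_ hr2
  nlinarith

theorem le_kernel_diag {c θ₀ ℓ : ℝ} {x : V} (hc : 0 ≤ c) (h : c ≤ E.survival ℓ x)
    (hℓ : 0 ≤ ℓ) (hθ₀ : 0 < θ₀) (hθ : ∑ y ∈ D, G.theta s y ≤ θ₀) :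
    c ^ 2 / θ₀ ≤ E.kernel (ℓ + ℓ) x x := by
  rw [div_le_iff₀ hθ₀]
  have h1 := E.sq_survival_le ℓ x
  have h2 : c ^ 2 ≤ E.survival ℓ x ^ 2 := by gcongr
  have h3 := mul_le_mul_of_nonneg_right hθ (E.kernel_nonneg (add_nonneg hℓ hℓ) x x)
  linarith

/-- Chaining of a lower bound in a subset. -/
theorem le_kernel_chain {D' : Finset V} (hsub : D' ⊆ D) {τ e v : ℝ} (hτ : 0 ≤ τ) (he : 0 ≤ e)
    (hv : 0 ≤ v) (hD' : v ≤ ∑ y ∈ D', G.theta s y)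
    (h : ∀ x ∈ D', ∀ y ∈ D', e ≤ E.kernel τ x y) (j : ℕ) :
    ∀ x ∈ D', ∀ y ∈ D', (v * e) ^ j * e ≤ E.kernel ((j + 1) * τ) x y := by
  induction j with
  | zero => simpa using h
  | succ j ih =>
    intro x hx y hy
    have ht : ((j + 1 : ℕ) + 1 : ℝ) * τ = (j + 1) * τ + τ := by push_cast; ring
    have hj : 0 ≤ ((j : ℝ) + 1) * τ := by positivity
    rw [ht, ← E.sum_kernel_mul_kernel]
    calc (v * e) ^ (j + 1) * e = v * ((v * e) ^ j * e * e) := by ring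
      _ ≤ (∑ z ∈ D', G.theta s z) * ((v * e) ^ j * e * e) := by gcongr
      _ = ∑ z ∈ D', G.theta s z * ((v * e) ^ j * e * e) := Finset.sum_mul _ _ _
      _ ≤ ∑ z ∈ D', G.theta s z * (E.kernel ((j + 1) * τ) x z * E.kernel τ z y) := by
          refine Finset.sum_le_sum fun z hz => mul_le_mul_of_nonneg_left ?_ (G.theta_pos s z).le
          exact mul_le_mul (ih x hx z hz) (h z hz y hy) he (E.kernel_nonneg hj x z)
      _ ≤ ∑ z ∈ D, G.theta s z * (E.kernel ((j + 1) * τ) x z * E.kernel τ z y) :=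
          Finset.sum_le_sum_of_subset_of_nonneg hsub fun z _ _ =>
            mul_nonneg (G.theta_pos s z).le
              (mul_nonneg (E.kernel_nonneg hj x z) (E.kernel_nonneg hτ z y))

end Eigenbasis
end WeightedGraph

/-! ### Consequences of the standing assumptions -/

namespace Assumptions

open WeightedGraph Filter Topology

variable {V : Type*} {M : ℕ} [Countable V] [MeasurableSpace V] [DiscreteMeasurableSpace V]
  {K : Constants} {G : WeightedGraph V M} {s : Speed} {x₀ : V}

lemma rpow_mul_sq (p α : ℝ) {r : ℝ} (hα : 0 < α) (hr : 0 < r) :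
    (α * r ^ 2) ^ p = α ^ p * r ^ (2 * p) := by
  rw [Real.mul_rpow hα.le (by positivity), Real.rpow_mul hr.le, Real.rpow_two]

/-- At time `α r²` the assumed bound holds in a ball of radius a constant times `r ^ (1 + δ₁)`,
which eventually contains `B(x₀, r)`. The graph enters only through the threshold hidden in the
filter, never through the constant. -/
theorem eventually_kernel_le (h : Assumptions K G s x₀) {α : ℝ} (hα : 0 < α) :
    ∀ᶠ r in atTop, ∀ D : Finset V, (D : Set V) = G.ball x₀ r → ∀ E : G.Eigenbasis s D,
      ∀ x ∈ D, ∀ y ∈ D, E.kernel (α * r ^ 2) x y ≤ K.c₁ * α ^ (-K.d / 2) * r ^ (-K.d) := by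
  obtain ⟨T₀, -, hT⟩ := h.heatKernel_le
  have h1 : ∀ᶠ r : ℝ in atTop, T₀ ≤ α * r ^ 2 :=
    ((tendsto_pow_atTop two_ne_zero).const_mul_atTop hα).eventually_ge_atTop T₀
  have h2 : ∀ᶠ r : ℝ in atTop, 1 ≤ α ^ ((1 + K.δ₁) / 2) * r ^ K.δ₁ :=
    ((tendsto_rpow_atTop K.δ₁_pos).const_mul_atTop (Real.rpow_pos_of_pos hα _)).eventually_ge_atTop 1
  filter_upwards [h1, h2, eventually_gt_atTop 0] with r hr1 hr2 hr0 D hD E x hx y hy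
  have hle : r ≤ (α * r ^ 2) ^ ((1 + K.δ₁) / 2) := by
    rw [rpow_mul_sq _ _ hα hr0, show 2 * ((1 + K.δ₁) / 2) = 1 + K.δ₁ by ring,
      Real.rpow_add hr0, Real.rpow_one]
    nlinarith
  have hmem : ∀ z ∈ D, z ∈ G.ball x₀ ((α * r ^ 2) ^ ((1 + K.δ₁) / 2)) := fun z hz =>
    G.ball_mono x₀ hle (hD ▸ Finset.mem_coe.2 hz)
  refine (E.kernel_le_heatKernel (by positivity) hx hy).trans
    ((hT _ hr1 x (hmem x hx) y (hmem y hy)).trans (le_of_eq ?_))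
  rw [rpow_mul_sq _ _ hα hr0, mul_assoc]
  congr 3
  ring

theorem eventually_volume (h : Assumptions K G s x₀) :
    ∀ᶠ r in atTop, ∀ D : Finset V, (D : Set V) = G.ball x₀ r →
      K.c₃ * r ^ K.d ≤ ∑ y ∈ D, G.theta s y ∧ ∑ y ∈ D, G.theta s y ≤ K.c₄ * r ^ K.d := by
  obtain ⟨R₂, hR₂, hR⟩ := h.volume
  filter_upwards [eventually_ge_atTop R₂] with r hr D hD
  rw [← G.thetaSet_coe, hD]
  exact ⟨(hR r hr).1, (hR r hr).2 x₀ (G.mem_ball_self x₀ (Real.rpow_pos_of_pos (by linarith) _))⟩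

theorem eventually_survival_le (h : Assumptions K G s x₀) {A : ℝ} (hA : 0 < A)
    (hA' : K.c₁ * K.c₄ * A ^ (-K.d / 2) ≤ 1 / 2) :
    ∀ᶠ r in atTop, ∀ D : Finset V, (D : Set V) = G.ball x₀ r → ∀ E : G.Eigenbasis s D,
      ∀ x ∈ D, E.survival (A * r ^ 2) x ≤ 1 / 2 := by
  filter_upwards [h.eventually_kernel_le hA, h.eventually_volume, eventually_gt_atTop 0]
    with r hr1 hr2 hr0 D hD E x hx
  have hc := mul_pos (mul_pos K.c₁_pos (Real.rpow_pos_of_pos hA (-K.d / 2)))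
    (Real.rpow_pos_of_pos hr0 (-K.d))
  calc E.survival (A * r ^ 2) x
      ≤ ∑ y ∈ D, G.theta s y * (K.c₁ * A ^ (-K.d / 2) * r ^ (-K.d)) :=
        Finset.sum_le_sum fun y hy =>
          mul_le_mul_of_nonneg_left (hr1 D hD E x hx y hy) (G.theta_pos s y).le
    _ = (∑ y ∈ D, G.theta s y) * (K.c₁ * A ^ (-K.d / 2) * r ^ (-K.d)) :=
        (Finset.sum_mul _ _ _).symm
    _ ≤ K.c₄ * r ^ K.d * (K.c₁ * A ^ (-K.d / 2) * r ^ (-K.d)) :=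
        mul_le_mul_of_nonneg_right (hr2 D hD).2 hc.le
    _ = K.c₁ * K.c₄ * A ^ (-K.d / 2) * (r ^ K.d * r ^ (-K.d)) := by ring
    _ = K.c₁ * K.c₄ * A ^ (-K.d / 2) := by
        rw [← Real.rpow_add hr0, add_neg_cancel, Real.rpow_zero, mul_one]
    _ ≤ 1 / 2 := hA'

/-- The constant in the lower bound of the mean exit times of balls for the graph distance. -/
noncomputable def exitConstant (K : Constants) : Speed → ℝ
  | .csrw => K.c₂
  | .vsrw => K.c₂ * K.c₅ ^ 2

lemma exitConstant_pos (K : Constants) (s : Speed) : 0 < exitConstant K s := by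
  have := K.c₂_pos
  have := K.c₅_pos
  cases s <;> simp only [exitConstant] <;> positivity

lemma meanExitTime_mono (G : WeightedGraph V M) (s : Speed) {A B : Set V} (hAB : A ⊆ B) (x : V) :
    G.meanExitTime s A x ≤ G.meanExitTime s B x := by
  refine lintegral_mono fun w => le_iInf₂ fun t ht => iInf₂_le t ?_
  rintro ⟨y, hy, hpos⟩
  exact ht ⟨y, hAB hy, hpos⟩

/-- For the VSRW, comparison of the metrics puts the `d̃`-ball of radius `c₅ r` inside `B(x₀, r)`,
and exit times increase with the set. This is where the factor `c₅ ^ 2` arises. -/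
theorem eventually_le_meanExitTime (h : Assumptions K G s x₀) :
    ∀ᶠ r in atTop,
      ENNReal.ofReal (exitConstant K s * r ^ 2) ≤ G.meanExitTime s (G.ball x₀ r) x₀ := by
  cases s with
  | csrw =>
    obtain ⟨R₀, hR₀, hR⟩ := h.exit_csrw rfl
    filter_upwards [eventually_ge_atTop R₀] with r hr
    exact hR r hr x₀ (G.mem_ball_self x₀ (Real.rpow_pos_of_pos (by linarith) _))
  | vsrw =>
    obtain ⟨R₀, hR₀, hR⟩ := h.exit_vsrw rfl
    obtain ⟨R₄, hR₄, hR'⟩ := h.dist_vsrw rfl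
    have h1 : ∀ᶠ r : ℝ in atTop, R₀ ≤ K.c₅ * r :=
      (tendsto_id.const_mul_atTop K.c₅_pos).eventually_ge_atTop R₀
    filter_upwards [h1, eventually_ge_atTop R₄] with r hr hr'
    have hx₀ : x₀ ∈ G.ballTilde x₀ ((K.c₅ * r) ^ (1 + K.δ₂)) :=
      (G.distTilde_self_le x₀).trans_lt (Real.rpow_pos_of_pos (by linarith) _)
    have hsub : G.ballTilde x₀ (K.c₅ * r) ⊆ G.ball x₀ r := by
      intro y hy
      by_contra hn
      have hd : r ≤ (G.graph.dist x₀ y : ℝ) := not_lt.1 hn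
      have h2 := hR' r hr' x₀ (G.mem_ball_self x₀ (by linarith)) y hd
      have h3 := mul_le_mul_of_nonneg_left hd K.c₅_pos.le
      have h4 : G.distTilde x₀ y < K.c₅ * r := hy
      linarith
    have h5 := (hR _ hr x₀ hx₀).trans (meanExitTime_mono G .vsrw hsub x₀)
    rwa [show K.c₂ * (K.c₅ * r) ^ 2 = exitConstant K .vsrw * r ^ 2 by
      simp only [exitConstant]; ring] at h5

/-- The constant is enlarged to at least one so that `(C - 1) / (C + 1)` is nonnegative. -/
theorem exists_ellipticHarnack (h : Assumptions K G s x₀) :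
    ∃ R₁, 1 ≤ R₁ ∧ G.EllipticHarnack s x₀ (max K.C_E 1) R₁ := by
  obtain ⟨R₁, hR₁, H⟩ := h.harnack
  refine ⟨R₁, hR₁, fun R hR f hpos hharm x hx y hy => (H R hR f hpos hharm x hx y hy).trans ?_⟩
  have hy' : 0 < f y := hpos y (Or.inl (G.ball_mono x₀ (by linarith) hy))
  exact mul_le_mul_of_nonneg_right (le_max_left _ _) hy'.le

end Assumptions
end RandomWalk

/-! ### Choice of parameters and conclusion. -/

namespace RandomWalk

open WeightedGraph Filter Topology

lemma exists_time_scale (K : Constants) :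
    ∃ A : ℝ, 0 < A ∧ K.c₁ * K.c₄ * A ^ (-K.d / 2) ≤ 1 / 2 := by
  have h := (tendsto_rpow_neg_atTop (half_pos K.d_pos)).const_mul (K.c₁ * K.c₄)
  rw [mul_zero] at h
  obtain ⟨A, hA, hA'⟩ :=
    ((eventually_gt_atTop 0).and (h.eventually_le_const (by norm_num : (0 : ℝ) < 1 / 2))).exists
  exact ⟨A, hA, by rwa [neg_div]⟩

/-- The parameters of the near-diagonal lower bound: the number `k` of steps, the factor `η` of the
radius of the ball in which oscillations are estimated, and the number `m` of applications of the
oscillation inequality. -/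
lemma exists_parameters {b A c q : ℝ} (hb : 0 < b) (hA : 0 < A) (hc : 0 < c)
    (hq1 : q < 1) (κ₀ : ℝ → ℝ) (hκ : ∀ k, 0 < k → 0 < κ₀ k) :
    ∃ (k : ℕ) (η : ℝ) (m : ℕ), 0 < k ∧ 1 ≤ b * k ∧ 0 < η ∧ η ≤ 1 / 2 ∧
      4 * (2 * A * η ^ 2 * k) * κ₀ k +
        q ^ m * (2 * (κ₀ k + 2 * (2 * A * η ^ 2 * k) * κ₀ k)) ≤ c / 4 := by
  obtain ⟨k, hk⟩ := exists_nat_ge (1 / b + 1)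
  have hb' : 0 < 1 / b := by positivity
  have hk0 : (0 : ℝ) < k := by linarith
  have hbk : 1 ≤ b * k := by
    have : 1 / b ≤ k := by linarith
    rw [div_le_iff₀ hb] at this
    linarith
  have hκ' := hκ k hk0
  have h0 : Tendsto (fun η : ℝ => 4 * (2 * A * η ^ 2 * k) * κ₀ k) (𝓝[>] 0) (𝓝 0) := by
    have : Tendsto (fun η : ℝ => 4 * (2 * A * η ^ 2 * k) * κ₀ k) (𝓝 0)
        (𝓝 (4 * (2 * A * 0 ^ 2 * k) * κ₀ k)) := Continuous.tendsto (by fun_prop) 0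
    simp only [ne_eq, OfNat.ofNat_ne_zero, not_false_eq_true, zero_pow, mul_zero, zero_mul] at this
    exact this.mono_left nhdsWithin_le_nhds
  have hI : ∀ᶠ η : ℝ in 𝓝[>] 0, η ∈ Ioo 0 (1 / 2) := Ioo_mem_nhdsGT (by norm_num)
  obtain ⟨η, ⟨hη0, hη1⟩, hη⟩ :=
    (hI.and (h0.eventually_le_const (by positivity : 0 < c / 8))).exists
  set β := 2 * (κ₀ k + 2 * (2 * A * η ^ 2 * k) * κ₀ k)
  have hβ : 0 < β := by positivity
  obtain ⟨m, hm⟩ := exists_pow_lt_of_lt_one (by positivity : 0 < c / 8 / β) hq1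
  rw [lt_div_iff₀ hβ] at hm
  exact ⟨k, η, m, by exact_mod_cast hk0, hbk, hη0, hη1.le, by linarith⟩

/-- The near-diagonal lower bound in terms of the radius. -/
theorem exists_dirichletHeatKernel_lower_bound (s : Speed) (M : ℕ) (K : Constants) :
    ∃ c ρ : ℝ, 0 < c ∧ 0 < ρ ∧ ρ < 1 ∧
      ∀ (V : Type*) [Countable V] [MeasurableSpace V] [DiscreteMeasurableSpace V]
        (G : WeightedGraph V M) (x₀ : V), Assumptions K G s x₀ →
        ∀ᶠ r in atTop, ∀ x ∈ G.ball x₀ (ρ * r), ∀ y ∈ G.ball x₀ (ρ * r),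
          c * r ^ (-K.d) ≤ G.dirichletHeatKernel s (G.ball x₀ r) (r ^ 2) x y := by
  set b := Assumptions.exitConstant K s
  have hb : 0 < b := Assumptions.exitConstant_pos K s
  obtain ⟨A, hA, hA'⟩ := exists_time_scale K
  set C := max K.C_E 1
  have hC : 1 ≤ C := le_max_right _ _
  set q := (C - 1) / (C + 1)
  have hq1 : q < 1 := by rw [div_lt_one (by linarith)]; linarith
  have hc₁ := K.c₁_pos
  have hc₃ := K.c₃_pos
  have hc₄ := K.c₄_pos
  set c := (b / (4 * A)) ^ 2 / K.c₄
  have hc : 0 < c := by positivity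
  -- The constant of the upper bound at time `r² / (2k)`, half a step.
  set κ₀ : ℝ → ℝ := fun k => K.c₁ * (1 / (2 * k)) ^ (-K.d / 2)
  obtain ⟨k, η, m, hk, hbk, hη, hη2, hpar⟩ := exists_parameters hb hA hc hq1 κ₀
    fun k hk => mul_pos hc₁ (Real.rpow_pos_of_pos (by positivity) _)
  have hk' : (0 : ℝ) < k := by exact_mod_cast hk
  set ρ := η / 4 ^ m
  have hρ : 0 < ρ := by positivity
  have hρη : ρ ≤ η := div_le_self hη.le (one_le_pow₀ (by norm_num))
  refine ⟨(K.c₃ * ρ ^ K.d * (c / 2)) ^ (k - 1) * (c / 2), ρ, by positivity, hρ, by linarith, ?_⟩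
  intro V _ _ _ G x₀ h
  obtain ⟨R₁, hR₁, H⟩ := h.exists_ellipticHarnack
  have hηt : Tendsto (fun r : ℝ => η * r) atTop atTop := tendsto_id.const_mul_atTop hη
  have hρt : Tendsto (fun r : ℝ => ρ * r) atTop atTop := tendsto_id.const_mul_atTop hρ
  filter_upwards [h.eventually_survival_le hA hA', hηt.eventually (h.eventually_survival_le hA hA'),
    h.eventually_kernel_le (α := 1 / (2 * k)) (by positivity), h.eventually_le_meanExitTime,
    h.eventually_volume, hρt.eventually h.eventually_volume, eventually_gt_atTop 0,
    hηt.eventually_ge_atTop (2 * R₁ * 4 ^ m)] with r hS hS' hker hexit hvol hvol' hr hrη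
  set D := (G.finite_ball x₀ r).toFinset
  set D₁ := (G.finite_ball x₀ (η * r)).toFinset
  set D₂ := (G.finite_ball x₀ (ρ * r)).toFinset
  have hD : (D : Set V) = G.ball x₀ r := Finite.coe_toFinset _
  have hD₁ : (D₁ : Set V) = G.ball x₀ (η * r) := Finite.coe_toFinset _
  have hD₂ : (D₂ : Set V) = G.ball x₀ (ρ * r) := Finite.coe_toFinset _
  have hsub₁ : D₁ ⊆ D := by
    rw [← Finset.coe_subset, hD, hD₁]
    exact G.ball_mono x₀ (by nlinarith)
  have hsub₂ : D₂ ⊆ D := by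
    rw [← Finset.coe_subset, hD, hD₂]
    exact G.ball_mono x₀ (by nlinarith)
  have hx₀ : x₀ ∈ D₂ := by
    rw [← Finset.mem_coe, hD₂]
    exact G.mem_ball_self x₀ (by positivity)
  obtain ⟨E⟩ := exists_eigenbasis G s D
  obtain ⟨E₁⟩ := exists_eigenbasis G s D₁
  have hU : 0 < r ^ (-K.d) := Real.rpow_pos_of_pos hr _
  set τ := r ^ 2 / k
  have hτ : 0 < τ := by positivity
  have hdiag : ∀ x ∈ D, E.kernel (τ / 2) x x ≤ κ₀ k * r ^ (-K.d) := by
    intro x hx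
    rw [show τ / 2 = 1 / (2 * k) * r ^ 2 by simp only [τ]; field_simp]
    exact hker D hD E x hx x hx
  -- The condition `1 ≤ b * k` is what makes `τ / 2` at most `b / 2 * r ^ 2`.
  have hsurv : b / (4 * A) ≤ E.survival (τ / 2) x₀ := by
    refine E.le_survival (hsub₂ hx₀) hA hr (hD ▸ hexit) (hS D hD E) (by positivity) ?_
    simp only [τ]
    rw [div_div, div_le_iff₀ (by positivity)]
    have : 0 < r ^ 2 := by positivity
    nlinarith
  have hx₀x₀ : c * r ^ (-K.d) ≤ E.kernel τ x₀ x₀ := by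
    have h1 := E.le_kernel_diag (by positivity) hsurv (by positivity)
      (mul_pos hc₄ (Real.rpow_pos_of_pos hr K.d)) (hvol D hD).2
    rw [add_halves] at h1
    refine le_trans (le_of_eq ?_) h1
    rw [Real.rpow_neg hr.le]
    simp only [c]
    field_simp
  have hosc : ∀ x ∈ D₂, ∀ y ∈ D₂, ∀ z ∈ D₂,
      E.kernel τ x y - E.kernel τ x z ≤ c / 4 * r ^ (-K.d) := by
    intro x hx y hy z hz
    have hball : G.ball x₀ (η * r / 4 ^ m) = (D₂ : Set V) := by
      rw [hD₂]; congr 1; simp only [ρ]; ring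
    have h1 := E.kernel_sub_le H hC hR₁ hrη hD₁ hsub₁ E₁ (T := A * (η * r) ^ 2) (by positivity)
      (hS' D₁ hD₁ E₁) hτ hdiag (ϑ := 2 * A * η ^ 2 * k)
      (le_of_eq (by simp only [τ]; field_simp)) (hsub₂ hx)
      (hball ▸ Finset.mem_coe.2 hy) (hball ▸ Finset.mem_coe.2 hz)
    refine h1.trans ?_
    have h2 := mul_le_mul_of_nonneg_right hpar hU.le
    refine le_trans (le_of_eq ?_) h2
    ring
  -- The arguments move one at a time, from `(x₀, x₀)` to `(x₀, x)` and, by symmetry, from `(x, x₀)`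
  -- to `(x, y)`; each move costs `c / 4`.
  have hlow : ∀ x ∈ D₂, ∀ y ∈ D₂, c / 2 * r ^ (-K.d) ≤ E.kernel τ x y := by
    intro x hx y hy
    have h1 := hosc x₀ hx₀ x₀ hx₀ x hx
    have h2 := hosc x hx x₀ hx₀ y hy
    rw [E.kernel_comm τ x x₀] at h2
    linarith
  -- A chain with `k - 1` intermediate points consists of `k` steps, of total duration `k τ = r²`.
  have hchain := E.le_kernel_chain hsub₂ hτ.le (by positivity)
    (v := K.c₃ * (ρ * r) ^ K.d) (by positivity) (hvol' D₂ hD₂).1 hlow (k - 1)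
  intro x hx y hy
  rw [← hD₂, Finset.mem_coe] at hx hy
  rw [← hD, E.dirichletHeatKernel_eq (by positivity) (hsub₂ hx) (hsub₂ hy)]
  have hkτ : (((k - 1 : ℕ) : ℝ) + 1) * τ = r ^ 2 := by
    have : ((k - 1 : ℕ) : ℝ) + 1 = k := by exact_mod_cast Nat.sub_add_cancel hk
    rw [this]
    simp only [τ]
    field_simp
  have h1 := hchain x hx y hy
  rw [hkτ] at h1
  have h2 : K.c₃ * (ρ * r) ^ K.d * (c / 2 * r ^ (-K.d)) = K.c₃ * ρ ^ K.d * (c / 2) := by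
    have h3 : r ^ K.d * r ^ (-K.d) = 1 := by
      rw [← Real.rpow_add hr, add_neg_cancel, Real.rpow_zero]
    rw [Real.mul_rpow hρ.le hr.le]
    linear_combination K.c₃ * ρ ^ K.d * (c / 2) * h3
  rw [h2] at h1
  linarith

end RandomWalk

theorem proposition1p4 (s : RandomWalk.Speed) (M : ℕ) (K : RandomWalk.Constants) :
    ∃ c₁ δ₀ : ℝ, 0 < c₁ ∧ c₁ < 1 ∧ 0 < δ₀ ∧ δ₀ < 1 ∧
      ∀ (V : Type*) [Countable V] [MeasurableSpace V] [DiscreteMeasurableSpace V]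
        (G : RandomWalk.WeightedGraph V M) (x₀ : V), RandomWalk.Assumptions K G s x₀ →
        ∃ T₁ : ℝ, 1 ≤ T₁ ∧ ∀ t : ℝ, T₁ ≤ t →
          ∀ x ∈ G.ball x₀ (δ₀ * t ^ (1 / 2 : ℝ)), ∀ y ∈ G.ball x₀ (δ₀ * t ^ (1 / 2 : ℝ)),
            c₁ * t ^ (-K.d / 2) ≤
              G.dirichletHeatKernel s (G.ball x₀ (t ^ (1 / 2 : ℝ))) t x y := by
  obtain ⟨c, ρ, hc, hρ, hρ1, H⟩ := RandomWalk.exists_dirichletHeatKernel_lower_bound s M K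
  -- The minimum only serves to make the constant less than one.
  refine ⟨min c (1 / 2), ρ, lt_min hc (by norm_num),
    (min_le_right _ _).trans_lt (by norm_num), hρ, hρ1, ?_⟩
  intro V _ _ _ G x₀ h
  -- The radius bound is used with `r = t ^ (1 / 2)`.
  have ht := (tendsto_rpow_atTop (by norm_num : (0 : ℝ) < 1 / 2)).eventually (H V G x₀ h)
  obtain ⟨T, hT⟩ := Filter.eventually_atTop.1 ht
  refine ⟨max T 1, le_max_right _ _, fun t htT x hx y hy => ?_⟩
  have ht1 : 1 ≤ t := (le_max_right _ _).trans htT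
  have ht0 : 0 ≤ t := zero_le_one.trans ht1
  have h1 := hT t ((le_max_left _ _).trans htT) x hx y hy
  have h2 : (t ^ (1 / 2 : ℝ)) ^ 2 = t := by
    rw [← Real.rpow_two, ← Real.rpow_mul ht0]; norm_num
  have h3 : (t ^ (1 / 2 : ℝ)) ^ (-K.d) = t ^ (-K.d / 2) := by
    rw [← Real.rpow_mul ht0]; congr 1; ring
  rw [h2, h3] at h1
  exact (mul_le_mul_of_nonneg_right (min_le_left _ _) (Real.rpow_nonneg ht0 _)).trans h1
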